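/- **Setting.** Let $p\ge 1$ and let $\mu$ be a probability density on $\mathbb R^p$; write $\langle u,g\rangle=\int u\,g\,dx$ and $p_C=\langle 1_C,\mu\rangle$. Let $\Theta$ be a nonempty compact metric space, $\mathcal V=\{\nu^\theta:\theta\in\Theta\}$ a family of probability densities and $\nu_0$ an initial density with $\{\mu>0\}\subseteq\{\nu_0>0\}$. Let $f^{(1)},\dots,f^{(K)},f^{(K+1)}=f^\star:\mathbb R^p\to\mathbb R^q$ be models with error bounds $\|f^\star(x)-f^{(k)}(x)\|_2\le\epsilon_k(x)$, $\epsilon_{K+1}=0$; let $h:\mathbb R^q\to\mathbb R$ be $c$-Lipschitz for $\|\cdot\|_2$ (e.g. linear, or the sup norm with $c=1$), $\phi^{(k)}=h\circ f^{(k)}$, $\phi=\phi^{(K+1)}$. Let $\gamma^\star\in\mathbb R$, $A=\{\phi\ge\gamma^\star\}$ with $p_A>0$, and $\delta>0$, $\beta>1$, $\rho_0\in(0,1)$. For samples $z_1,z_2,\dots$ of a density $\nu_j$ let $\hat\nu_j$ be the empirical measure of the first $m_j$ of them, $\gamma(\hat\nu_j,\rho,\psi)=\max\{s:\langle 1_{\psi<s},\hat\nu_j\rangle\le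 1-\rho\}$ and $\alpha_k(\hat\nu_j)=c\max_{i\le m_j}\epsilon_k(z_i)$. The zero-variance density of a set $C$ is $\nu_C^\star=1_C\mu/p_C$. The importance sampling estimator is $p^{IS}_{A,\nu}=\frac1N\sum_{i\le N}1_A(z_i)\mu(z_i)/\nu(z_i)$ with $z_i$ i.i.d. from $\nu$, and its SCV is $\mathbb E[(p^{IS}_{A,\nu}-p_A)^2]/p_A^2$. **Algorithm.** Start with $j=0$, $m_0\ge1$ samples of $\nu_0$, quantile parameter $\rho_0$, and $k_0=1$. Abbreviate $\gamma_j=\gamma(\hat\nu_j,\rho_j,\phi^{(k_j)})$ and $\alpha_j=\alpha_{k_j}(\hat\nu_j)$. While $\gamma_j<\gamma^\star+\alpha_j$: put $$\hat A_{j+1}=\{\phi\ge\min(\gamma(\hat\nu_j,\rho_j,\phi),\gamma^\star)\},\qquad \hat A^{(k_j)}_{j+1}=\{\phi^{(k_j)}\ge\min(\gamma_j-2\alpha_j,\gamma^\star+\alpha_j)\};$$ let $\nu_{j+1}=\nu^\theta$ for any maximizer $\theta$ of $\frac1{m_j}\sum_{i\le m_j}1_{\hat A^{(k_j)}_{j+1}}(z_i)\frac{\mu(z_i)}{\nu_j(z_i)}\ln\nu^\theta(z_i)$;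 draw $n$ fresh samples of $\nu_{j+1}$, where $n=m_j$ by default and $n\ge m_j$ may be chosen larger; and, starting from $(n,\rho_j,k_j)$, adapt $(m,\rho,k)$ until $$\text{(a)}\ \ \gamma(\hat\nu_{j+1},\rho,\phi^{(k)})\ge\bar\gamma:=\min\{\gamma^\star+\alpha_k(\hat\nu_{j+1}),\ \gamma_j+2\alpha_j+\delta\}\qquad\text{and}\qquad\text{(b)}\ \ \alpha_k(\hat\nu_{j+1})\le\alpha_j .$$ The adaptation repeats the following step until (a) and (b) hold. If $k\le K$, and (b) fails or $\varpi\le0$, increase $k$ by one. Otherwise (if $k=K+1$, or (b) and $\varpi>0$ hold) repeat, until (a) holds: set $\rho$ to the largest value in $(0,1)$ for which (a) holds if there is one, and else enlarge the sample to $\lceil\beta m\rceil$. Here $\varpi=\underline\rho-\bar\eta$, where $\underline\rho$ and $\bar\rho$ are the empirical probabilities of $\phi^{(k)}\ge\bar\gamma+\alpha_k$ and $\phi^{(k)}\ge\bar\gamma-\alpha_k$ respectively, and $\bar\eta$ is the largest empirical probability of $\phi^{(k)}\in[\gamma',\gamma'+\alpha_k]$ over $\gamma'\in[\gamma(\hat\nu_{j+1},\bar\rho,\phi^{(k)}),\gamma(\hat\nu_{j+1},\underline\rho,\phi^{(k)})]$;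 then pass to $j+1$. When the loop is left, at index $J-1$, the output is $\hat\nu_A^{\theta^\star}=\nu_J=\nu^\theta$ for any maximizer $\theta$ of $\frac1{m_{J-1}}\sum_{i\le m_{J-1}}1_A(z_i)\frac{\mu(z_i)}{\nu_{J-1}(z_i)}\ln\nu^\theta(z_i)$. **Assumptions.** A: $\{\mu>0\}\subseteq\{\nu^\theta>0\}$ for every $\theta$. B: $\Theta$ is compact; $\theta\mapsto\ln\nu^\theta(x)$ is continuous for $\mu$-almost every $x$; and there is a $\mu$-integrable $H$ with $|\ln\nu^\theta(x)|\le H(x)$ for all $\theta,x$. **Theorem.** Suppose that A and B hold. "Almost surely" refers to the successive draws of the sample sequences, each given the previous ones, and a limit in $m_j$ is taken for arbitrary fixed outcomes of the iterations before $j$. 1. Almost surely all adaptation loops terminate, all maximizers exist, the quantile increase condition $\gamma(\hat\nu_{j+1},\rho_{j+1},\phi)\ge\min\{\gamma^\star,\gamma(\hat\nu_j,\rho_j,\phi)+\delta\}$ holds along the run, and the algorithm ends after $J\le\hat J_{\max}=\lceil(\gamma^\star-\gamma(\hat\nu_0,\rho_0,\phi))/\delta\rceil+1$ iterations if $\gamma(\hat\nu_0,\rho_0,\phi)<\gamma^\star$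 (and $J\le2$ otherwise). The set $\Theta^\star=\operatorname{argmax}_\theta\langle1_A\ln\nu^\theta,\mu\rangle$ is nonempty, and almost surely, as $m_{J-1}\to\infty$, the parameters of the output density converge to $\Theta^\star$ (their distance to $\Theta^\star$ tends to $0$). 2. Consider an iteration $j$ inside the loop, with relaxed set $R=\hat A_j^{(k_{j-1})}$. Almost surely, as $m_{j-1}\to\infty$, $\nu_j$ asymptotically solves the exact problem for $R$: $\max_\theta\langle1_R\ln\nu^\theta,\mu\rangle-\langle1_R\ln\nu_j,\mu\rangle\to0$. The SCV of the exact solution is as follows. If $\nu^\star_R\in\mathcal V$, every $\nu\in\mathcal V$ that maximizes $\langle1_R\ln\nu,\mu\rangle$ has, for every sample size $N\ge1$ of the estimator, $$\frac1{p_A^2}\mathbb E[(p^{IS}_{A,\nu}-p_A)^2]=\frac1{Np_A}\left(p_{\hat A_j\setminus A}+p_{R\setminus\hat A_j}\right).$$ More generally, for any family $\mathcal W\ni\nu_R^\star$ of densities that are positive $\mu$-a.e. on $A$, every minimizer over $\mathcal W$ of the Kullback-Leibler divergence from $\nu_R^\star$ has SCV $\frac1{Np_A}(p_{\hat A_j\setminus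 A}+p_{R\setminus\hat A_j}-p_{\hat A_j\setminus R})$, and almost surely $p_{\hat A_j\setminus R}\to0$ as $m_{j-1}\to\infty$. 3. This SCV is minimal among feasible relaxed sets. Given $\hat\nu_{j-1},\rho_{j-1}$ of the run, call a measurable set $B$ feasible if for every measurable score $\psi$ with $|\psi-\phi^{(k_{j-1})}|\le\alpha_{k_{j-1}}(\hat\nu_{j-1})$ it contains $\{\psi\ge\min(\gamma(\hat\nu_{j-1},\rho_{j-1},\psi),\gamma^\star)\}$. Then $R$ is feasible, and every feasible $B$ satisfies $p_{R\setminus\hat A_j}\le p_{B\setminus\hat A_j}$ and, if $\nu_R^\star$ is positive $\mu$-a.e. on $A$, the SCV obtained with $\nu_R^\star$ is at most the one obtained with $\nu_B^\star$. 4. If $\nu_A^\star\in\mathcal V$, every maximizer $\nu\in\mathcal V$ of $\langle1_A\ln\nu,\mu\rangle$ has SCV zero; more generally, so has every minimizer, over any family of densities that contains $\nu_A^\star$, of the Kullback-Leibler divergence from $\nu_A^\star$. -/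

import Mathlib

open MeasureTheory ProbabilityTheory Filter Topology Set
open scoped ENNReal NNReal

noncomputable section

namespace CEMethod

/-- The sample space `ℝ^p`. -/
abbrev Pt (p : ℕ) := EuclideanSpace ℝ (Fin p)

/-- A probability density on `ℝ^p` (with respect to Lebesgue measure). -/
structure Density (p : ℕ) where
  toFun : Pt p → ℝ
  measurable : Measurable toFun
  nonneg : ∀ x, 0 ≤ toFun x
  mass : ∫⁻ x, ENNReal.ofReal (toFun x) = 1

instance (p : ℕ) : CoeFun (Density p) (fun _ => Pt p → ℝ) := ⟨Density.toFun⟩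

/-- The probability distribution with density `g`. -/
def Density.law {p : ℕ} (g : Density p) : Measure (Pt p) :=
  volume.withDensity (fun x => ENNReal.ofReal (g x))

instance Density.isProbabilityMeasure_law {p : ℕ} (g : Density p) :
    IsProbabilityMeasure g.law :=
  ⟨by rw [Density.law, withDensity_apply _ MeasurableSet.univ, Measure.restrict_univ]
      exact g.mass⟩

/-- The law of an infinite sequence of i.i.d. samples from `g`; an algorithm that uses `m` samples
reads the first `m` terms, and reads further terms when it draws additional samples. -/
def Density.streamLaw {p : ℕ} (g : Density p) : Measure (ℕ → Pt p) :=
  Measure.infinitePi (fun _ : ℕ => g.law)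

/-! ### Empirical quantities -/

/-- Empirical probability of `P` under the first `m` samples. -/
def frac {p : ℕ} (z : ℕ → Pt p) (m : ℕ) (P : Pt p → Prop) : ℝ :=
  open Classical in (((Finset.range m).filter (fun i => P (z i))).card : ℝ) / m

/-- Empirical `(1 - r)`-quantile of the score `ψ`; for `1 ≤ m` and `0 < r < 1` the set below is
nonempty, closed and bounded above, so that the supremum is a maximum. -/
def quantile {p : ℕ} (z : ℕ → Pt p) (m : ℕ) (r : ℝ) (ψ : Pt p → ℝ) : ℝ :=
  sSup {s : ℝ | frac z m (fun x => ψ x < s) ≤ 1 - r}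

/-! ### The setting -/

/-- The data of the method: the density `μ` of interest, the initial proposal `ν₀`, the
parametrized family `ν`, the hierarchy `f` of `K` reduced models completed by the high-fidelity
model `f (Fin.last K)`, the scores `h ∘ f k`, and the a posteriori error bounds `ε k`.
The levels `1, …, K + 1` are numbered `0, …, K` here. -/
structure Model (p q K : ℕ) (Θ : Type*) where
  μ : Density p
  ν₀ : Density p
  ν : Θ → Density p
  f : Fin (K + 1) → Pt p → EuclideanSpace ℝ (Fin q)
  h : EuclideanSpace ℝ (Fin q) → ℝ
  c : ℝ≥0
  ε : Fin (K + 1) → Pt p → ℝ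
  /-- the target score -/
  γstar : ℝ
  /-- the minimal quantile increase -/
  δ : ℝ
  /-- the sample size growth factor -/
  β : ℝ
  /-- the initial quantile parameter -/
  ρ₀ : ℝ
  measurable_f : ∀ k, Measurable (f k)
  measurable_ε : ∀ k, Measurable (ε k)
  lipschitz_h : LipschitzWith c h
  error_bound : ∀ k x, ‖f (Fin.last K) x - f k x‖ ≤ ε k x
  error_last : ∀ x, ε (Fin.last K) x = 0
  ν₀_support : ∀ x, 0 < μ x → 0 < ν₀ x
  δ_pos : 0 < δ
  one_lt_β : 1 < β
  ρ₀_pos : 0 < ρ₀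
  ρ₀_lt_one : ρ₀ < 1

namespace Model

variable {p q K : ℕ} {Θ : Type*} (M : Model p q K Θ)

/-- The score approximation of level `k`. -/
def φ (k : Fin (K + 1)) : Pt p → ℝ := fun x => M.h (M.f k x)

/-- The high-fidelity score. -/
def score : Pt p → ℝ := M.φ (Fin.last K)

/-- The rare event. -/
def A : Set (Pt p) := {x | M.γstar ≤ M.score x}

/-- The probability `p_C` of a set under `μ`. -/
def prob (C : Set (Pt p)) : ℝ := M.μ.law.real C

/-- Support domination: the support of `μ` is contained in the support of every proposal. -/
def AssumptionA : Prop := ∀ θ x, 0 < M.μ x → 0 < M.ν θ x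

/-- Continuity in the parameter and integrable envelope (compactness of the parameter set is
the instance `CompactSpace Θ`). -/
def AssumptionB [TopologicalSpace Θ] : Prop :=
  (∀ᵐ x ∂M.μ.law, Continuous (fun θ => Real.log (M.ν θ x))) ∧
  ∃ H : Pt p → ℝ, Integrable H M.μ.law ∧ ∀ θ x, |Real.log (M.ν θ x)| ≤ H x

/-! ### Cross-entropy problems -/

/-- The exact objective `⟨1_C ln ν^θ, μ⟩`. -/
def popCE (C : Set (Pt p)) (θ : Θ) : ℝ := ∫ x in C, Real.log (M.ν θ x) ∂M.μ.law

/-- The (parameters of the) optimal cross-entropy densities: `argmax_θ ⟨1_C ln ν^θ, μ⟩`. -/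
def ceArgmax (C : Set (Pt p)) : Set Θ := {θ | ∀ θ', M.popCE C θ' ≤ M.popCE C θ}

/-- The Monte Carlo objective `(1/m) ∑ 1_C(z_i) (μ(z_i)/g(z_i)) ln ν^θ(z_i)`. -/
def empCE (g : Density p) (z : ℕ → Pt p) (m : ℕ) (C : Set (Pt p)) (θ : Θ) : ℝ :=
  (1 / (m : ℝ)) * ∑ i ∈ Finset.range m,
    C.indicator (fun _ => (1 : ℝ)) (z i) * (M.μ (z i) / g (z i)) * Real.log (M.ν θ (z i))

/-- `θ` solves the Monte Carlo problem. -/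
def IsEmpCE (g : Density p) (z : ℕ → Pt p) (m : ℕ) (C : Set (Pt p)) (θ : Θ) : Prop :=
  ∀ θ', M.empCE g z m C θ' ≤ M.empCE g z m C θ

/-- The zero-variance distribution, of density `1_C μ / p_C`, for the set `C`. -/
def zeroVar (C : Set (Pt p)) : Measure (Pt p) := ProbabilityTheory.cond M.μ.law C

/-- `w` minimizes over the family `W` the Kullback-Leibler divergence from the zero-variance
distribution of `C`. -/
def IsCEDensity (W : Set (Density p)) (C : Set (Pt p)) (w : Density p) : Prop :=
  w ∈ W ∧ ∀ w' ∈ W,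
    InformationTheory.klDiv (M.zeroVar C) w.law ≤ InformationTheory.klDiv (M.zeroVar C) w'.law

/-- The support of `1_C μ` is contained in the support of `w`, up to null sets. -/
def Dominates (C : Set (Pt p)) (w : Density p) : Prop := ∀ᵐ x ∂M.μ.law, x ∈ C → 0 < w x

/-! ### The importance sampling estimator -/

/-- The importance sampling estimator of `p_A` from `N` samples of `w`. -/
def isEst {N : ℕ} (w : Density p) (z : Fin N → Pt p) : ℝ :=
  (1 / (N : ℝ)) * ∑ i, M.A.indicator (fun _ => (1 : ℝ)) (z i) * (M.μ (z i) / w (z i))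

/-- Its squared coefficient of variation `E[(p^IS - p_A)²] / p_A²` for i.i.d. samples of `w`. -/
def scv (N : ℕ) (w : Density p) : ℝ≥0∞ :=
  (∫⁻ z, ENNReal.ofReal ((M.isEst w z - M.prob M.A) ^ 2) ∂Measure.pi (fun _ : Fin N => w.law)) /
    ENNReal.ofReal (M.prob M.A ^ 2)

/-! ### Adaptation of the sample size, the quantile parameter and the level -/

/-- The sampled error bound `c max_{i < m} ε_k(z_i)`. -/
def errHat (z : ℕ → Pt p) (m : ℕ) (k : Fin (K + 1)) : ℝ := M.c * ⨆ i : Fin m, M.ε k (z i)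

/-- The score `min {γ* + α_k, γt}` that the quantile has to reach. -/
def target (z : ℕ → Pt p) (γt : ℝ) (m : ℕ) (k : Fin (K + 1)) : ℝ :=
  min (M.γstar + M.errHat z m k) γt

/-- The quantile increase condition. -/
def CondGamma (z : ℕ → Pt p) (γt : ℝ) (m : ℕ) (r : ℝ) (k : Fin (K + 1)) : Prop :=
  M.target z γt m k ≤ quantile z m r (M.φ k)

/-- The error decrease condition. -/
def CondError (z : ℕ → Pt p) (αprev : ℝ) (m : ℕ) (k : Fin (K + 1)) : Prop :=
  M.errHat z m k ≤ αprev

/-- Sampled lower bound of the probability to reach the target. -/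
def rhoLow (z : ℕ → Pt p) (γt : ℝ) (m : ℕ) (k : Fin (K + 1)) : ℝ :=
  frac z m (fun x => M.target z γt m k + M.errHat z m k ≤ M.φ k x)

/-- Sampled upper bound of the probability to reach the target. -/
def rhoUp (z : ℕ → Pt p) (γt : ℝ) (m : ℕ) (k : Fin (K + 1)) : ℝ :=
  frac z m (fun x => M.target z γt m k - M.errHat z m k ≤ M.φ k x)

/-- The largest sampled probability of an interval `[γ', γ' + α_k]`, for `γ'` between the two
quantiles. When `rhoLow = 0` the upper quantile is infinite; its value is then irrelevant, since
`varpi ≤ 0` in any case. -/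
def etaUp (z : ℕ → Pt p) (γt : ℝ) (m : ℕ) (k : Fin (K + 1)) : ℝ :=
  sSup ((fun γ' => frac z m (fun x => M.φ k x ∈ Icc γ' (γ' + M.errHat z m k))) ''
    Icc (quantile z m (M.rhoUp z γt m k) (M.φ k)) (quantile z m (M.rhoLow z γt m k) (M.φ k)))

/-- The selection criterion. -/
def varpi (z : ℕ → Pt p) (γt : ℝ) (m : ℕ) (k : Fin (K + 1)) : ℝ :=
  M.rhoLow z γt m k - M.etaUp z γt m k

/-- Terminating executions `(m, r) ↦ (m', r')` of the loop that adapts the sample size and the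
quantile parameter at a fixed level `k`, on the sample stream `z`. -/
inductive AdaptSample (z : ℕ → Pt p) (γt : ℝ) (k : Fin (K + 1)) : ℕ → ℝ → ℕ → ℝ → Prop
  | finish (m : ℕ) (r : ℝ) (hc : M.CondGamma z γt m r k) : AdaptSample z γt k m r m r
  | tune (m : ℕ) (r r₁ : ℝ) (m' : ℕ) (r' : ℝ) (hc : ¬ M.CondGamma z γt m r k)
      (hg : IsGreatest {r₂ : ℝ | r₂ ∈ Ioo (0 : ℝ) 1 ∧ M.CondGamma z γt m r₂ k} r₁)
      (next : AdaptSample z γt k m r₁ m' r') : AdaptSample z γt k m r m' r'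
  | grow (m : ℕ) (r : ℝ) (m' : ℕ) (r' : ℝ) (hc : ¬ M.CondGamma z γt m r k)
      (hn : ¬ ∃ r₂ ∈ Ioo (0 : ℝ) 1, M.CondGamma z γt m r₂ k)
      (next : AdaptSample z γt k ⌈M.β * m⌉₊ r m' r') : AdaptSample z γt k m r m' r'

/-- Terminating executions `(m, r, k) ↦ (m', r', k')` of the loop that adapts the sample size and
the quantile parameter and selects the level, on the sample stream `z`. -/
inductive Adapt (z : ℕ → Pt p) (γt αprev : ℝ) :
    ℕ → ℝ → Fin (K + 1) → ℕ → ℝ → Fin (K + 1) → Prop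
  | done (m : ℕ) (r : ℝ) (k : Fin (K + 1))
      (hc : M.CondError z αprev m k ∧ M.CondGamma z γt m r k) : Adapt z γt αprev m r k m r k
  | top (m : ℕ) (r : ℝ) (k : Fin (K + 1)) (m₁ : ℕ) (r₁ : ℝ)
      (m' : ℕ) (r' : ℝ) (k' : Fin (K + 1))
      (hc : ¬ (M.CondError z αprev m k ∧ M.CondGamma z γt m r k))
      (hk : k = Fin.last K) (hs : M.AdaptSample z γt k m r m₁ r₁)
      (next : Adapt z γt αprev m₁ r₁ k m' r' k') : Adapt z γt αprev m r k m' r' k'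
  | select (m : ℕ) (r : ℝ) (k : Fin (K + 1)) (m₁ : ℕ) (r₁ : ℝ)
      (m' : ℕ) (r' : ℝ) (k' : Fin (K + 1))
      (hc : ¬ (M.CondError z αprev m k ∧ M.CondGamma z γt m r k))
      (hk : k ≠ Fin.last K) (hw : M.CondError z αprev m k ∧ 0 < M.varpi z γt m k)
      (hs : M.AdaptSample z γt k m r m₁ r₁)
      (next : Adapt z γt αprev m₁ r₁ k m' r' k') : Adapt z γt αprev m r k m' r' k'
  | refine (m : ℕ) (r : ℝ) (k k₁ : Fin (K + 1)) (m' : ℕ) (r' : ℝ) (k' : Fin (K + 1))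
      (hc : ¬ (M.CondError z αprev m k ∧ M.CondGamma z γt m r k))
      (hk : k ≠ Fin.last K) (hw : ¬ (M.CondError z αprev m k ∧ 0 < M.varpi z γt m k))
      (hk₁ : (k₁ : ℕ) = k + 1)
      (next : Adapt z γt αprev m r k₁ m' r' k') : Adapt z γt αprev m r k m' r' k'

end Model

/-! ### Stages and runs of the algorithm -/

/-- The state `(ν_j, (z_i)_i, m_j, ρ_j, k_j)` at the test of the main loop. -/
structure Stage (p K : ℕ) where
  g : Density p
  z : ℕ → Pt p
  m : ℕ
  ρ : ℝ
  k : Fin (K + 1)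

namespace Stage

variable {p q K : ℕ} {Θ : Type*} (M : Model p q K Θ) (s : Stage p K)

/-- Sampled quantile of the high-fidelity score. -/
def γφ : ℝ := quantile s.z s.m s.ρ M.score

/-- Sampled quantile of the selected score approximation. -/
def γk : ℝ := quantile s.z s.m s.ρ (M.φ s.k)

/-- Sampled error bound of the selected score approximation. -/
def α : ℝ := M.errHat s.z s.m s.k

/-- The main loop is left. -/
def Stopped : Prop := M.γstar + s.α M ≤ s.γk M

/-- The next set `{φ ≥ min(γ, γ*)}` of the standard method. -/
def stdSet : Set (Pt p) := {x | min (s.γφ M) M.γstar ≤ M.score x}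

/-- The next relaxed set. -/
def relSet : Set (Pt p) :=
  {x | min (s.γk M - 2 * s.α M) (M.γstar + s.α M) ≤ M.φ s.k x}

/-- `θ` is a possible update of the proposal inside the loop. -/
def IsUpdate (θ : Θ) : Prop := M.IsEmpCE s.g s.z s.m (s.relSet M) θ

/-- `θ` is a possible output of the algorithm, once the loop is left. -/
def IsOutput (θ : Θ) : Prop := M.IsEmpCE s.g s.z s.m M.A θ

/-- `s'` is the next stage, with updated proposal `ν θ`, sample stream `z` drawn from it, and
starting sample size `n`. -/
def Next (θ : Θ) (z : ℕ → Pt p) (n : ℕ) (s' : Stage p K) : Prop :=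
  s'.g = M.ν θ ∧ s'.z = z ∧
  M.Adapt z (s.γk M + 2 * s.α M + M.δ) (s.α M) n s.ρ s.k s'.m s'.ρ s'.k

/-- The quantile increase condition of the standard method, for the high-fidelity score. -/
def QuantileIncrease (s' : Stage p K) : Prop := min M.γstar (s.γφ M + M.δ) ≤ s'.γφ M

/-- `B` is admissible as a relaxed set: for every score `ψ` that is compatible with the selected
approximation and its error bound, `B` contains the set that the standard method builds
from `ψ`. -/
def Feasible (B : Set (Pt p)) : Prop :=
  MeasurableSet B ∧ ∀ ψ : Pt p → ℝ, Measurable ψ → (∀ x, |ψ x - M.φ s.k x| ≤ s.α M) →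
    {x | min (quantile s.z s.m s.ρ ψ) M.γstar ≤ ψ x} ⊆ B

/-- The squared coefficient of variation attached to the relaxed set: for the given family `ν`
(first part), and for any family `W` of densities that dominate `1_A μ` (second part). -/
def SCVFormula : Prop :=
  ((∃ θ, (M.ν θ).law = M.zeroVar (s.relSet M)) →
    ∀ θ ∈ M.ceArgmax (s.relSet M), ∀ N : ℕ, 1 ≤ N →
      M.scv N (M.ν θ) = ENNReal.ofReal (1 / (N * M.prob M.A) *
        (M.prob (s.stdSet M \ M.A) + M.prob (s.relSet M \ s.stdSet M)))) ∧
  ∀ W : Set (Density p), (∀ w ∈ W, M.Dominates M.A w) →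
    (∃ w ∈ W, w.law = M.zeroVar (s.relSet M)) →
    ∀ w, M.IsCEDensity W (s.relSet M) w → ∀ N : ℕ, 1 ≤ N →
      M.scv N w = ENNReal.ofReal (1 / (N * M.prob M.A) *
        (M.prob (s.stdSet M \ M.A) + M.prob (s.relSet M \ s.stdSet M)
          - M.prob (s.stdSet M \ s.relSet M)))

/-- The relaxed set is feasible, and no feasible set has a smaller excess probability or a
smaller squared coefficient of variation. -/
def SCVMinimal : Prop :=
  s.Feasible M (s.relSet M) ∧ ∀ B, s.Feasible M B →
    M.prob (s.relSet M \ s.stdSet M) ≤ M.prob (B \ s.stdSet M) ∧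
    ∀ w w' : Density p, M.Dominates M.A w → w.law = M.zeroVar (s.relSet M) →
      w'.law = M.zeroVar B → ∀ N : ℕ, 1 ≤ N → M.scv N w ≤ M.scv N w'

end Stage

section Runs

variable {p q K : ℕ} {Θ : Type*} [PseudoMetricSpace Θ] (M : Model p q K Θ)

/-- What is claimed of a set `S` of stages that share one proposal and one sample stream and
differ in sample size: the exact statements inside the loop, and the limits for growing sample
sizes. -/
def StageClaims (S : Set (Stage p K)) : Prop :=
  (∀ s ∈ S, ¬ s.Stopped M → s.SCVFormula M ∧ s.SCVMinimal M) ∧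
  ∀ η > (0 : ℝ), ∃ m₀ : ℕ, ∀ s ∈ S, m₀ ≤ s.m →
    (s.Stopped M → ∀ θ, s.IsOutput M θ → Metric.infDist θ (M.ceArgmax M.A) < η) ∧
    (¬ s.Stopped M → M.prob (s.stdSet M \ s.relSet M) < η ∧
      ∀ θ, s.IsUpdate M θ →
        ∀ θ', M.popCE (s.relSet M) θ' - M.popCE (s.relSet M) θ < η)

/-- `AlmostSureRun M J s`: almost surely, the algorithm started from stage `s` terminates within
`J` iterations (the final one included), and along the run the quantile increase condition and
the `StageClaims` hold. The sample streams are drawn one after the other, each from the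
proposal just selected, and 'almost surely' refers to each draw given the previous ones. All
solutions of the Monte Carlo problems and all starting sample sizes `n ≥ m_j` are allowed; `n = m_j`
is the default of the algorithm, larger values let the sample size grow. -/
def AlmostSureRun : ℕ → Stage p K → Prop
  | 0, _ => False
  | J + 1, s =>
      (s.Stopped M ∧ ∃ θ, s.IsOutput M θ) ∨
      (¬ s.Stopped M ∧ (∃ θ, s.IsUpdate M θ) ∧
        ∀ θ, s.IsUpdate M θ → ∀ᵐ z ∂(M.ν θ).streamLaw,
          (∀ n, s.m ≤ n → ∃ s', s.Next M θ z n s') ∧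
          StageClaims M {s' | ∃ n, s.m ≤ n ∧ s.Next M θ z n s'} ∧
          ∀ n, s.m ≤ n → ∀ s', s.Next M θ z n s' →
            s.QuantileIncrease M s' ∧ AlmostSureRun J s')

/-- The initial stage with `m` samples: quantile parameter `ρ₀` and coarsest level. -/
def initStage (z : ℕ → Pt p) (m : ℕ) : Stage p K := ⟨M.ν₀, z, m, M.ρ₀, 0⟩

/-- `⌈(γ* - γ(ν̂₀, ρ₀, φ)) / δ⌉ + 1`. -/
def Jmax (s : Stage p K) : ℤ := ⌈(M.γstar - s.γφ M) / M.δ⌉ + 1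

end Runs

end CEMethod

end

/-!
Each claim along a run is deterministic once the sample stream of the current proposal is *good*
(`Model.GoodStream`), and almost every stream of a proposal that is positive wherever `μ` is
positive is good (`Model.ae_goodStream`).

*Termination.* On the samples `|φ - φ^(k)| ≤ α_k`, and quantiles are monotone in the score, so the
quantiles of `φ` and `φ^(k)` differ by at most `α_k`. With the two conditions reached by the
adaptation, this gives the quantile increase condition (`Stage.Next.quantileIncrease`), and shows
that the loop is left at the test that follows a quantile of `φ` within `δ` of `γ*`
(`Stage.Next.stopped`). The adaptation itself terminates as soon as the stream hits `A`
(`Model.exists_adapt`): `ϖ > 0` already provides a sample that reaches the target, and at the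
high-fidelity level the target is at most `γ*`.

*Squared coefficient of variation.* Under the zero-variance density of a set `C ⊇ A` the weight
`μ / w` is the constant `p_C`, so the estimator averages `p_C 1_A` and has squared coefficient of
variation `(p_C - p_A) / (N p_A)` (`Model.scv_of_law_eq`). A divergence minimizer over a family that
contains the zero-variance density is that density, and within the parametric family equality in
Gibbs' inequality gives the same (`Model.law_eq_of_mem_ceArgmax`). Minimality holds because every
feasible set contains the relaxed set up to the finitely many samples
(`Stage.Admissible.relSet_ae_subset`).

*Limits.* The relaxed sets depend on the samples, so the law of large numbers has to be uniform over
the superlevel sets `{φ^(k) ≥ t}` as well as over `Θ`. With the thresholds `t` ranging over the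
compact space of extended reals, the functions `1_{φ^(k) ≥ t} ln ν^θ` have finite bracketings by
compactness (`hasBrackets_indicator`), and bracketing reduces the uniform law to the strong law for
countably many functions (`ae_uniform_weightedMean`). The same uniform law, applied to `ε_k`, bounds
the probability that the error bound at a new point exceeds all sampled ones
(`Model.ae_prob_iSup_lt`), and this event contains the standard set minus the relaxed set.
-/

namespace CEMethod

/-! ### Empirical frequencies and quantiles -/

section Empirical

variable {p : ℕ} {z : ℕ → Pt p} {m : ℕ}

lemma frac_nonneg (P : Pt p → Prop) : 0 ≤ frac z m P := by
  unfold frac; positivity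

lemma frac_mono {P Q : Pt p → Prop} (h : ∀ i < m, P (z i) → Q (z i)) :
    frac z m P ≤ frac z m Q := by
  classical
  unfold frac
  gcongr with i hi
  simpa using h i (by simpa using hi)

lemma frac_lt_eq (hm : 1 ≤ m) (ψ : Pt p → ℝ) (s : ℝ) :
    frac z m (fun x => ψ x < s) = 1 - frac z m (fun x => s ≤ ψ x) := by
  classical
  have hm' : (m : ℝ) ≠ 0 := by positivity
  have h := Finset.card_filter_add_card_filter_not (s := Finset.range m) (fun i => ψ (z i) < s)
  simp only [not_lt, Finset.card_range] at h
  have h' := congrArg (Nat.cast : ℕ → ℝ) h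
  push_cast at h'
  unfold frac
  rw [eq_sub_iff_add_eq, ← add_div, div_eq_one_iff_eq hm']
  convert h'

lemma frac_pos_of_mem {P : Pt p → Prop} {i : ℕ} (hi : i < m) (h : P (z i)) :
    0 < frac z m P := by
  classical
  unfold frac
  have : 0 < ((Finset.range m).filter (fun i => P (z i))).card :=
    Finset.card_pos.2 ⟨i, by simp [hi, h]⟩
  have : 0 < m := by omega
  positivity

/-- The defining property of the quantile; the supremum in the definition is attained because only
finitely many samples are involved. -/
lemma le_quantile_iff (hm : 1 ≤ m) {r : ℝ} (hr : r ∈ Ioo (0 : ℝ) 1) (ψ : Pt p → ℝ) (s : ℝ) :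
    s ≤ quantile z m r ψ ↔ r ≤ frac z m (fun x => s ≤ ψ x) := by
  classical
  have hS : {s : ℝ | frac z m (fun x => ψ x < s) ≤ 1 - r}
      = {s | r ≤ frac z m (fun x => s ≤ ψ x)} := by
    ext s; simp only [mem_ofPred_eq, frac_lt_eq hm]; constructor <;> intro h <;> linarith
  have hq : quantile z m r ψ = sSup {s | r ≤ frac z m (fun x => s ≤ ψ x)} := by
    unfold quantile; rw [hS]
  set S : Set ℝ := {s | r ≤ frac z m (fun x => s ≤ ψ x)} with hSdef
  have hne : (Finset.range m).Nonempty := ⟨0, by simp; omega⟩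
  have hdown : ∀ s ∈ S, ∀ t ≤ s, t ∈ S := fun s hs t hts =>
    le_trans hs (frac_mono fun i _ h => hts.trans h)
  have hmem : ((Finset.range m).inf' hne fun i => ψ (z i)) ∈ S := by
    have : frac z m (fun x => ((Finset.range m).inf' hne fun i => ψ (z i)) ≤ ψ x) = 1 := by
      unfold frac
      rw [Finset.filter_true_of_mem]
      · simp; omega
      · intro i hi; exact Finset.inf'_le (fun i => ψ (z i)) hi
    simp only [hSdef, mem_ofPred_eq, this]; exact hr.2.le
  have hbdd : BddAbove S := by
    refine ⟨(Finset.range m).sup' hne fun i => ψ (z i), fun s hs => ?_⟩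
    by_contra hlt
    push Not at hlt
    have : frac z m (fun x => s ≤ ψ x) = 0 := by
      unfold frac
      rw [Finset.filter_false_of_mem]
      · simp
      · intro i hi h
        exact absurd (Finset.le_sup' (fun i => ψ (z i)) hi) (not_le.2 (hlt.trans_le h))
    have hs' : r ≤ frac z m (fun x => s ≤ ψ x) := hs
    rw [this] at hs'; exact absurd hr.1 (not_lt.2 hs')
  -- the samples with score below the supremum stay below some element of the set
  have hsup : sSup S ∈ S := by
    obtain ⟨t, htS, ht⟩ : ∃ t ∈ S, ∀ i < m, ψ (z i) < sSup S → ψ (z i) < t := by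
      by_cases hT : ((Finset.range m).filter fun i => ψ (z i) < sSup S).Nonempty
      · obtain ⟨i, hi, hmax⟩ := Finset.exists_max_image _ (fun i => ψ (z i)) hT
        obtain ⟨t, htS, ht⟩ := exists_lt_of_lt_csSup ⟨_, hmem⟩ (Finset.mem_filter.1 hi).2
        exact ⟨t, htS, fun j hj hjs => (hmax j (by simp [hj, hjs])).trans_lt ht⟩
      · refine ⟨_, hmem, fun i hi his => absurd ⟨i, ?_⟩ hT⟩
        simp [hi, his]
    refine le_trans htS (frac_mono fun i hi h => ?_)
    by_contra hc
    exact absurd (ht i hi (not_le.1 hc)) (not_lt.2 h)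
  rw [hq]
  exact ⟨fun h => hdown _ hsup _ h, fun h => le_csSup hbdd h⟩

lemma quantile_le_add (hm : 1 ≤ m) {r : ℝ} (hr : r ∈ Ioo (0 : ℝ) 1) {ψ ψ' : Pt p → ℝ} {a : ℝ}
    (h : ∀ i < m, ψ (z i) ≤ ψ' (z i) + a) : quantile z m r ψ ≤ quantile z m r ψ' + a := by
  rw [← sub_le_iff_le_add, le_quantile_iff hm hr]
  refine ((le_quantile_iff hm hr ψ _).1 le_rfl).trans (frac_mono fun i hi hq => ?_)
  linarith [h i hi]

end Empirical

/-! ### Sampled error bounds -/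

namespace Model

variable {p q K : ℕ} {Θ : Type*} (M : Model p q K Θ) {z : ℕ → Pt p} {m : ℕ}

lemma ε_nonneg (k : Fin (K + 1)) (x : Pt p) : 0 ≤ M.ε k x :=
  (norm_nonneg _).trans (M.error_bound k x)

lemma measurable_φ (k : Fin (K + 1)) : Measurable (M.φ k) :=
  M.lipschitz_h.continuous.measurable.comp (M.measurable_f k)

lemma measurableSet_A : MeasurableSet M.A :=
  measurableSet_le measurable_const (M.measurable_φ _)

lemma abs_score_sub_φ_le (k : Fin (K + 1)) (x : Pt p) : |M.score x - M.φ k x| ≤ M.c * M.ε k x := by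
  have h := M.lipschitz_h.dist_le_mul (M.f (Fin.last K) x) (M.f k x)
  rw [Real.dist_eq, dist_eq_norm] at h
  exact h.trans (mul_le_mul_of_nonneg_left (M.error_bound k x) M.c.2)

lemma errHat_nonneg (k : Fin (K + 1)) : 0 ≤ M.errHat z m k :=
  mul_nonneg M.c.2 (Real.iSup_nonneg fun _ => M.ε_nonneg _ _)

lemma errHat_last : M.errHat z m (Fin.last K) = 0 := by
  simp [errHat, M.error_last]

lemma ε_le_iSup (k : Fin (K + 1)) {i : ℕ} (hi : i < m) :
    M.ε k (z i) ≤ ⨆ i : Fin m, M.ε k (z i) :=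
  le_ciSup (f := fun i : Fin m => M.ε k (z i)) (finite_range _).bddAbove ⟨i, hi⟩

lemma abs_score_sub_φ_le_errHat (k : Fin (K + 1)) {i : ℕ} (hi : i < m) :
    |M.score (z i) - M.φ k (z i)| ≤ M.errHat z m k :=
  (M.abs_score_sub_φ_le k _).trans (mul_le_mul_of_nonneg_left (M.ε_le_iSup k hi) M.c.2)

lemma quantile_score_le (hm : 1 ≤ m) {r : ℝ} (hr : r ∈ Ioo (0 : ℝ) 1) (k : Fin (K + 1)) :
    quantile z m r M.score ≤ quantile z m r (M.φ k) + M.errHat z m k :=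
  quantile_le_add hm hr fun _ hi => by
    linarith [(abs_le.1 (M.abs_score_sub_φ_le_errHat (z := z) k hi)).2]

lemma quantile_φ_le (hm : 1 ≤ m) {r : ℝ} (hr : r ∈ Ioo (0 : ℝ) 1) (k : Fin (K + 1)) :
    quantile z m r (M.φ k) ≤ quantile z m r M.score + M.errHat z m k :=
  quantile_le_add hm hr fun _ hi => by
    linarith [(abs_le.1 (M.abs_score_sub_φ_le_errHat (z := z) k hi)).1]

/-! ### Termination of the adaptation loops -/

lemma condGamma_iff (hm : 1 ≤ m) {r : ℝ} (hr : r ∈ Ioo (0 : ℝ) 1) (γt : ℝ) (k : Fin (K + 1)) :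
    M.CondGamma z γt m r k ↔ r ≤ frac z m (fun x => M.target z γt m k ≤ M.φ k x) :=
  le_quantile_iff hm hr _ _

lemma AdaptSample.invariants {γt : ℝ} {k : Fin (K + 1)} {m' : ℕ} {r r' : ℝ}
    (h : M.AdaptSample z γt k m r m' r') (hr : r ∈ Ioo (0 : ℝ) 1) :
    m ≤ m' ∧ r' ∈ Ioo (0 : ℝ) 1 ∧ M.CondGamma z γt m' r' k := by
  induction h with
  | finish m r hc => exact ⟨le_rfl, hr, hc⟩
  | tune m r r₁ m' r' hc hg next ih => exact ih hg.1.1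
  | grow m r m' r' hc hn next ih =>
    obtain ⟨h1, h2, h3⟩ := ih hr
    refine ⟨le_trans ?_ h1, h2, h3⟩
    have : (m : ℝ) ≤ M.β * m := le_mul_of_one_le_left (by positivity) M.one_lt_β.le
    exact_mod_cast this.trans (Nat.le_ceil _)

lemma Adapt.invariants {γt αprev : ℝ} {k k' : Fin (K + 1)} {m' : ℕ} {r r' : ℝ}
    (h : M.Adapt z γt αprev m r k m' r' k') (hr : r ∈ Ioo (0 : ℝ) 1) :
    m ≤ m' ∧ r' ∈ Ioo (0 : ℝ) 1 ∧ M.CondError z αprev m' k' ∧ M.CondGamma z γt m' r' k' := by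
  induction h with
  | done m r k hc => exact ⟨le_rfl, hr, hc⟩
  | top m r k m₁ r₁ m' r' k' hc hk hs next ih =>
    obtain ⟨h1, h2, -⟩ := AdaptSample.invariants M hs hr
    obtain ⟨h3, h4⟩ := ih h2
    exact ⟨h1.trans h3, h4⟩
  | select m r k m₁ r₁ m' r' k' hc hk hw hs next ih =>
    obtain ⟨h1, h2, -⟩ := AdaptSample.invariants M hs hr
    obtain ⟨h3, h4⟩ := ih h2
    exact ⟨h1.trans h3, h4⟩
  | refine m r k k₁ m' r' k' hc hk hw hk₁ next ih => exact ih hr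

/-- If some sample reaches the target, tuning the quantile parameter is enough: the largest
admissible value is the sampled frequency of reaching the target. -/
lemma exists_adaptSample_of_frac_pos (hm : 1 ≤ m) {r : ℝ} (hr : r ∈ Ioo (0 : ℝ) 1) (γt : ℝ)
    (k : Fin (K + 1)) (h : 0 < frac z m (fun x => M.target z γt m k ≤ M.φ k x)) :
    ∃ m' r', M.AdaptSample z γt k m r m' r' := by
  by_cases hc : M.CondGamma z γt m r k
  · exact ⟨m, r, .finish m r hc⟩
  · set b := frac z m (fun x => M.target z γt m k ≤ M.φ k x) with hb
    have hbr : b < r := by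
      rw [M.condGamma_iff hm hr] at hc
      exact not_le.1 hc
    have hb01 : b ∈ Ioo (0 : ℝ) 1 := ⟨h, hbr.trans hr.2⟩
    have hcb : M.CondGamma z γt m b k := (M.condGamma_iff hm hb01 γt k).2 le_rfl
    refine ⟨m, b, .tune m r b m b hc ⟨⟨hb01, hcb⟩, fun r₂ hr₂ => ?_⟩ (.finish m b hcb)⟩
    exact (M.condGamma_iff hm hr₂.1 γt k).1 hr₂.2

/-- At the high-fidelity level the target is at most `γ*`, so the loop ends once the growing sample
contains a point of `A`. -/
lemma exists_adaptSample_last {i₀ : ℕ} (hi₀ : z i₀ ∈ M.A) {r : ℝ} (hr : r ∈ Ioo (0 : ℝ) 1)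
    (γt : ℝ) : ∀ (d m : ℕ), 1 ≤ m → i₀ < m + d →
      ∃ m' r', M.AdaptSample z γt (Fin.last K) m r m' r' := by
  intro d
  induction d with
  | zero =>
    intro m hm hi
    refine M.exists_adaptSample_of_frac_pos hm hr γt _ (frac_pos_of_mem (i := i₀) (by omega) ?_)
    refine (min_le_left _ _).trans ?_
    rw [errHat_last, add_zero]
    exact hi₀
  | succ d ih =>
    intro m hm hi
    by_cases hf : 0 < frac z m (fun x => M.target z γt m (Fin.last K) ≤ M.φ (Fin.last K) x)
    · exact M.exists_adaptSample_of_frac_pos hm hr γt _ hf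
    · have hno : ∀ r₂ ∈ Ioo (0 : ℝ) 1, ¬ M.CondGamma z γt m r₂ (Fin.last K) := by
        intro r₂ hr₂ hc
        rw [M.condGamma_iff hm hr₂] at hc
        exact hf (hr₂.1.trans_le hc)
      have hlt : m < ⌈M.β * m⌉₊ := by
        rw [Nat.lt_ceil]
        have : (0 : ℝ) < m := by positivity
        nlinarith [M.one_lt_β]
      obtain ⟨m', r', h⟩ := ih ⌈M.β * m⌉₊ (by omega) (by omega)
      exact ⟨m', r', .grow m r m' r' (hno r hr) (fun ⟨r₂, h₁, h₂⟩ => hno r₂ h₁ h₂) h⟩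

lemma frac_pos_of_varpi_pos {γt : ℝ} {k : Fin (K + 1)} (h : 0 < M.varpi z γt m k) :
    0 < frac z m (fun x => M.target z γt m k ≤ M.φ k x) := by
  have h1 : 0 ≤ M.etaUp z γt m k := Real.sSup_nonneg (by
    rintro _ ⟨γ', -, rfl⟩; exact frac_nonneg _)
  have h2 : 0 < M.rhoLow z γt m k := by unfold varpi at h; linarith
  refine h2.trans_le (frac_mono fun i _ hi => ?_)
  linarith [M.errHat_nonneg (z := z) (m := m) k]

/-- The adaptation terminates on every stream that hits the rare event. After the inner loop at a
level, either both conditions hold or the level is refined. -/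
lemma exists_adapt (hz : ∃ i, z i ∈ M.A) {γt αprev : ℝ} (hα : 0 ≤ αprev) :
    ∀ (d m : ℕ) (r : ℝ) (k : Fin (K + 1)), 1 ≤ m → r ∈ Ioo (0 : ℝ) 1 → (k : ℕ) + d = K →
      ∃ m' r' k', M.Adapt z γt αprev m r k m' r' k' := by
  obtain ⟨i₀, hi₀⟩ := hz
  intro d
  induction d with
  | zero =>
    intro m r k hm hr hk
    obtain rfl : k = Fin.last K := Fin.ext (by simpa using hk)
    by_cases hc : M.CondError z αprev m (Fin.last K) ∧ M.CondGamma z γt m r (Fin.last K)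
    · exact ⟨_, _, _, .done m r _ hc⟩
    · obtain ⟨m₁, r₁, hs⟩ := M.exists_adaptSample_last hi₀ hr γt (i₀ + 1) m hm (by omega)
      refine ⟨_, _, _, .top m r _ m₁ r₁ m₁ r₁ _ hc rfl hs (.done m₁ r₁ _ ⟨?_, ?_⟩)⟩
      · unfold CondError; rw [errHat_last]; exact hα
      · exact (AdaptSample.invariants M hs hr).2.2
  | succ d ih =>
    have hstep : ∀ (m : ℕ) (r : ℝ) (k : Fin (K + 1)), 1 ≤ m → r ∈ Ioo (0 : ℝ) 1 →
        (k : ℕ) + (d + 1) = K → ¬ (M.CondError z αprev m k ∧ 0 < M.varpi z γt m k) →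
        ∃ m' r' k', M.Adapt z γt αprev m r k m' r' k' := by
      intro m r k hm hr hk hw
      by_cases hc : M.CondError z αprev m k ∧ M.CondGamma z γt m r k
      · exact ⟨_, _, _, .done m r _ hc⟩
      · have hklt : (k : ℕ) + 1 < K + 1 := by omega
        obtain ⟨m', r', k', h⟩ := ih m r ⟨k + 1, hklt⟩ hm hr (by simp only; omega)
        refine ⟨m', r', k', .refine m r k _ m' r' k' hc ?_ hw rfl h⟩
        rintro rfl; simp at hk
    intro m r k hm hr hk
    by_cases hw : M.CondError z αprev m k ∧ 0 < M.varpi z γt m k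
    · by_cases hc : M.CondError z αprev m k ∧ M.CondGamma z γt m r k
      · exact ⟨_, _, _, .done m r _ hc⟩
      · obtain ⟨m₁, r₁, hs⟩ :=
          M.exists_adaptSample_of_frac_pos hm hr γt k (M.frac_pos_of_varpi_pos hw.2)
        obtain ⟨h1, h2, h3⟩ := AdaptSample.invariants M hs hr
        obtain ⟨m', r', k', h⟩ : ∃ m' r' k', M.Adapt z γt αprev m₁ r₁ k m' r' k' := by
          by_cases he : M.CondError z αprev m₁ k
          · exact ⟨_, _, _, .done m₁ r₁ _ ⟨he, h3⟩⟩
          · exact hstep m₁ r₁ k (by omega) h2 hk fun h => he h.1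
        refine ⟨m', r', k', .select m r k m₁ r₁ m' r' k' hc ?_ hw hs h⟩
        rintro rfl; simp at hk
    · exact hstep m r k hm hr hk hw

end Model

/-! ### One iteration of the main loop -/

namespace Stage

variable {p q K : ℕ} {Θ : Type*} (M : Model p q K Θ) {s s' : Stage p K}

/-- The invariant of a run: at least one sample, and a quantile parameter strictly between zero and
one. -/
def Admissible (s : Stage p K) : Prop := 1 ≤ s.m ∧ s.ρ ∈ Ioo (0 : ℝ) 1

lemma α_nonneg : 0 ≤ s.α M := M.errHat_nonneg _

lemma Admissible.γφ_le (hs : s.Admissible) : s.γφ M ≤ s.γk M + s.α M :=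
  M.quantile_score_le hs.1 hs.2 _

lemma Admissible.γk_le (hs : s.Admissible) : s.γk M ≤ s.γφ M + s.α M :=
  M.quantile_φ_le hs.1 hs.2 _

variable {M}

lemma Next.admissible {θ : Θ} {z : ℕ → Pt p} {n : ℕ} (hs : s.Admissible) (hn : s.m ≤ n)
    (h : s.Next M θ z n s') : s'.Admissible := by
  obtain ⟨h1, h2, -⟩ := Model.Adapt.invariants M h.2.2 hs.2
  exact ⟨(hs.1.trans hn).trans h1, h2⟩

lemma Next.target_le {θ : Θ} {z : ℕ → Pt p} {n : ℕ} (hs : s.Admissible)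
    (h : s.Next M θ z n s') :
    min (M.γstar + s'.α M) (s.γk M + 2 * s.α M + M.δ) ≤ s'.γk M := by
  obtain ⟨-, -, -, h4⟩ := Model.Adapt.invariants M h.2.2 hs.2
  have h4' : M.CondGamma s'.z _ _ _ _ := h.2.1 ▸ h4
  exact h4'

lemma Next.α_le {θ : Θ} {z : ℕ → Pt p} {n : ℕ} (hs : s.Admissible)
    (h : s.Next M θ z n s') : s'.α M ≤ s.α M := by
  obtain ⟨-, -, h3, -⟩ := Model.Adapt.invariants M h.2.2 hs.2
  have h3' : M.CondError s'.z _ _ _ := h.2.1 ▸ h3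
  exact h3'

lemma Next.quantileIncrease {θ : Θ} {z : ℕ → Pt p} {n : ℕ} (hs : s.Admissible) (hn : s.m ≤ n)
    (h : s.Next M θ z n s') : s.QuantileIncrease M s' := by
  have h1 := h.target_le hs
  have h2 := h.α_le hs
  have h3 := (h.admissible hs hn).γk_le M
  have h4 := hs.γφ_le M
  unfold QuantileIncrease
  rcases min_le_iff.1 h1 with h1 | h1
  · exact (min_le_left _ _).trans (by linarith)
  · exact (min_le_right _ _).trans (by linarith)

/-- Once the high-fidelity quantile is within `δ` of `γ*`, the main loop is left at the next
test. -/
lemma Next.stopped {θ : Θ} {z : ℕ → Pt p} {n : ℕ} (hs : s.Admissible)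
    (h : s.Next M θ z n s') (hγ : M.γstar ≤ s.γφ M + M.δ) : s'.Stopped M := by
  have h1 := h.target_le hs
  have h2 := h.α_le hs
  have h4 := hs.γφ_le M
  unfold Stopped
  rcases min_le_iff.1 h1 with h1 | h1 <;> linarith

lemma exists_next (hs : s.Admissible) (θ : Θ) {z : ℕ → Pt p} (hz : ∃ i, z i ∈ M.A) {n : ℕ}
    (hn : s.m ≤ n) : ∃ s', s.Next M θ z n s' := by
  obtain ⟨m', r', k', h⟩ := M.exists_adapt hz (γt := s.γk M + 2 * s.α M + M.δ)
    (α_nonneg M (s := s)) (K - s.k) n s.ρ s.k (hs.1.trans hn) hs.2 (by omega)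
  exact ⟨⟨M.ν θ, z, m', r', k'⟩, rfl, rfl, h⟩

end Stage

/-! ### Zero-variance densities and the variance of the importance sampling estimator -/

section

variable {p : ℕ}

lemma Density.measurable_ofReal (g : Density p) : Measurable fun x => ENNReal.ofReal (g x) :=
  g.measurable.ennreal_ofReal

lemma Density.law_absolutelyContinuous (g : Density p) : g.law ≪ volume :=
  withDensity_absolutelyContinuous _ _

lemma Density.ae_law_iff (g : Density p) {P : Pt p → Prop} :
    (∀ᵐ x ∂g.law, P x) ↔ ∀ᵐ x, 0 < g x → P x := by
  rw [Density.law, ae_withDensity_iff g.measurable_ofReal]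
  simp [g.nonneg, lt_iff_le_and_ne, eq_comm]

lemma Density.ae_pos (g : Density p) : ∀ᵐ x ∂g.law, 0 < g x :=
  g.ae_law_iff.2 (ae_of_all _ fun _ h => h)

end

namespace Model

variable {p q K : ℕ} {Θ : Type*} (M : Model p q K Θ)

lemma prob_mono_ae {C D : Set (Pt p)} (h : ∀ᵐ x ∂M.μ.law, x ∈ C → x ∈ D) :
    M.prob C ≤ M.prob D :=
  ENNReal.toReal_mono (measure_ne_top _ _) (measure_mono_ae h)

variable {M} in
lemma prob_pos_of_law_eq {w : Density p} {C : Set (Pt p)} (hw : w.law = M.zeroVar C) :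
    0 < M.prob C := by
  have h0 : M.μ.law C ≠ 0 := by
    intro h
    have h1 := congrArg (fun ν : Measure (Pt p) => ν univ) hw
    simp [zeroVar, cond_eq_zero_of_meas_eq_zero h] at h1
  exact ENNReal.toReal_pos h0 (measure_ne_top _ _)

variable {M} in
lemma density_ae_eq_of_law_eq {w : Density p} {C : Set (Pt p)} (hC : MeasurableSet C)
    (hw : w.law = M.zeroVar C) :
    ∀ᵐ x, w x = (M.prob C)⁻¹ * C.indicator M.μ x := by
  have hp := prob_pos_of_law_eq hw
  have h1 : M.zeroVar C = volume.withDensity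
      ((M.μ.law C)⁻¹ • C.indicator fun x => ENNReal.ofReal (M.μ x)) := by
    rw [zeroVar, ProbabilityTheory.cond, withDensity_smul _ (M.μ.measurable_ofReal.indicator hC),
      withDensity_indicator hC, Density.law, restrict_withDensity hC]
  rw [h1, Density.law, withDensity_eq_iff w.measurable_ofReal.aemeasurable
    ((M.μ.measurable_ofReal.indicator hC).const_smul _).aemeasurable (by rw [w.mass]; simp)] at hw
  filter_upwards [hw] with x hx
  have h2 := congrArg ENNReal.toReal hx
  rw [ENNReal.toReal_ofReal (w.nonneg x)] at h2
  rw [h2, Pi.smul_apply, smul_eq_mul, ENNReal.toReal_mul, ENNReal.toReal_inv]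
  congr 1
  by_cases hxC : x ∈ C <;> simp [hxC, M.μ.nonneg]

variable {M} in
lemma ae_mem_of_law_eq {w : Density p} {C : Set (Pt p)} (hC : MeasurableSet C)
    (hw : w.law = M.zeroVar C) {D : Set (Pt p)} (hD : M.Dominates D w) :
    ∀ᵐ x ∂M.μ.law, x ∈ D → x ∈ C := by
  filter_upwards [hD, M.μ.law_absolutelyContinuous.ae_le (density_ae_eq_of_law_eq hC hw)]
    with x hx hwx hxD
  by_contra hxC
  have := hx hxD
  simp [hwx, hxC] at this

variable {M} in
lemma dominates_of_law_eq {w : Density p} {C : Set (Pt p)} (hC : MeasurableSet C)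
    (hw : w.law = M.zeroVar C) {D : Set (Pt p)} (hD : ∀ᵐ x ∂M.μ.law, x ∈ D → x ∈ C) :
    M.Dominates D w := by
  have hp := prob_pos_of_law_eq hw
  filter_upwards [hD, M.μ.law_absolutelyContinuous.ae_le (density_ae_eq_of_law_eq hC hw),
    M.μ.ae_pos] with x hx hwx hμ hxD
  rw [hwx, indicator_of_mem (hx hxD)]
  positivity

/-- Sampling from the zero-variance density of a set `C` that contains `A` up to a null set: the
weight `μ / w` equals `p_C` on the support of `w`, so that the estimator averages the variables
`p_C 1_A`. -/
lemma scv_of_law_eq (hpA : 0 < M.prob M.A) {w : Density p} {C : Set (Pt p)}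
    (hC : MeasurableSet C) (hw : w.law = M.zeroVar C) (hD : M.Dominates M.A w) {N : ℕ}
    (hN : 1 ≤ N) :
    M.scv N w = ENNReal.ofReal (1 / (N * M.prob M.A) * (M.prob C - M.prob M.A)) := by
  have hpC := prob_pos_of_law_eq hw
  set a := M.prob M.A with ha
  set c := M.prob C with hc
  set Y : Pt p → ℝ := fun x => M.A.indicator (fun _ => (1 : ℝ)) x * (M.μ x / w x) with hY
  set X : Pt p → ℝ := fun x => c * M.A.indicator (fun _ => (1 : ℝ)) x with hX
  have hYX : Y =ᵐ[w.law] X := by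
    filter_upwards [w.law_absolutelyContinuous.ae_le (density_ae_eq_of_law_eq hC hw), w.ae_pos]
      with x hx hpos
    by_cases hxC : x ∈ C
    · rw [indicator_of_mem hxC] at hx
      have : M.μ x / w x = c := by
        rw [div_eq_iff hpos.ne', hx, mul_inv_cancel_left₀ hpC.ne']
      simp only [hY, hX, this]; ring
    · simp [hx, hxC] at hpos
  have hwA : w.law.real M.A = a / c := by
    rw [hw, zeroVar, measureReal_def, cond_apply hC, ENNReal.toReal_mul, ENNReal.toReal_inv]
    have : M.μ.law (C ∩ M.A) = M.μ.law M.A := by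
      refine measure_congr ?_
      filter_upwards [ae_mem_of_law_eq hC hw hD] with x hx
      exact propext ⟨fun h => h.2, fun h => ⟨hx h, h⟩⟩
    rw [this, div_eq_inv_mul]; rfl
  have hXm : Measurable X := (measurable_const.indicator M.measurableSet_A).const_mul _
  have hXL : MemLp X 2 w.law := by
    refine MemLp.of_bound hXm.aestronglyMeasurable c (ae_of_all _ fun x => ?_)
    by_cases hx : x ∈ M.A <;> simp [hX, hx, abs_of_pos hpC, hpC.le]
  have hYL : MemLp Y 2 w.law := hXL.ae_eq hYX.symm
  have hint : ∫ x, M.A.indicator (fun _ => (1 : ℝ)) x ∂w.law = a / c := by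
    rw [integral_indicator_const _ M.measurableSet_A, hwA, smul_eq_mul, mul_one]
  have hEX : ∫ x, X x ∂w.law = a := by
    rw [hX, integral_const_mul, hint, mul_div_cancel₀ _ hpC.ne']
  have hEX2 : ∫ x, (X ^ 2) x ∂w.law = c * a := by
    have : X ^ 2 = fun x => c ^ 2 * M.A.indicator (fun _ => (1 : ℝ)) x := by
      ext x; by_cases hx : x ∈ M.A <;> simp [hX, hx]
    rw [this, integral_const_mul, hint]; field_simp
  have hVY : Var[Y; w.law] = c * a - a ^ 2 := by
    rw [variance_congr hYX, variance_eq_sub hXL, hEX2, hEX]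
  have hEY : ∫ x, Y x ∂w.law = a := by rw [integral_congr_ae hYX, hEX]
  set P := Measure.pi (fun _ : Fin N => w.law) with hP
  have hmp : ∀ i : Fin N, MeasurePreserving (fun z : Fin N → Pt p => z i) P w.law :=
    fun i => measurePreserving_eval _ i
  have hYi : ∀ i : Fin N, MemLp (fun z : Fin N → Pt p => Y (z i)) 2 P :=
    fun i => hYL.comp_measurePreserving (hmp i)
  have hest : (fun z : Fin N → Pt p => M.isEst w z)
      = fun z => (1 / (N : ℝ)) * (∑ i, fun z : Fin N → Pt p => Y (z i)) z := by
    ext z; simp [isEst, hY]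
  have hS : MemLp (∑ i, fun z : Fin N → Pt p => Y (z i)) 2 P :=
    memLp_finsetSum' _ fun i _ => hYi i
  have hN0 : (N : ℝ) ≠ 0 := by positivity
  have hEi : ∀ i : Fin N, ∫ z, Y (z i) ∂P = a := fun i => by
    have h1 := (hmp i).map_eq
    have h2 := integral_map (μ := P) (φ := fun z : Fin N → Pt p => z i) (f := Y)
      (hmp i).measurable.aemeasurable (by rw [h1]; exact hYL.aestronglyMeasurable)
    rw [h1, hEY] at h2
    exact h2.symm
  have hE : ∫ z, M.isEst w z ∂P = a := by
    rw [hest, integral_const_mul]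
    simp only [Finset.sum_apply]
    rw [integral_finsetSum _ fun i _ => (hYi i).integrable (by norm_num)]
    simp only [hEi, Finset.sum_const, Finset.card_univ, Fintype.card_fin, nsmul_eq_mul]
    field_simp
  have hV : Var[fun z => M.isEst w z; P] = (c * a - a ^ 2) / N := by
    rw [hest, variance_const_mul, hP, variance_sum_pi fun _ => hYL]
    simp only [hVY, Finset.sum_const, Finset.card_univ, Fintype.card_fin, nsmul_eq_mul]
    field_simp
  have hL : MemLp (fun z => M.isEst w z) 2 P := by
    rw [hest]; exact hS.const_mul _
  have hev : ∫⁻ z, ENNReal.ofReal ((M.isEst w z - a) ^ 2) ∂P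
      = ENNReal.ofReal ((c * a - a ^ 2) / N) := by
    rw [← hV, ofReal_variance hL, evariance_eq_lintegral_ofReal, hE]
  rw [scv, hev, ← ENNReal.ofReal_div_of_pos (by positivity)]
  congr 1
  rw [← ha]
  field_simp

/-! ### Exact solutions of the cross-entropy problems -/

variable {M} in
lemma IsCEDensity.law_eq {W : Set (Density p)} {C : Set (Pt p)} {w : Density p}
    (hw : M.IsCEDensity W C w) (hW : ∃ w ∈ W, w.law = M.zeroVar C) : w.law = M.zeroVar C := by
  obtain ⟨w₀, hw₀, hlaw⟩ := hW
  have h := hw.2 w₀ hw₀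
  rw [← hlaw, InformationTheory.klDiv_self] at h
  rw [← hlaw]
  exact (InformationTheory.klDiv_eq_zero_iff.1 (le_antisymm h zero_le)).symm

variable {M}

lemma ae_mem_of_exists_law_eq (hA : M.AssumptionA) {C : Set (Pt p)} (hC : MeasurableSet C)
    (h : ∃ θ, (M.ν θ).law = M.zeroVar C) : ∀ᵐ x ∂M.μ.law, x ∈ C := by
  obtain ⟨θ, hθ⟩ := h
  have hD : M.Dominates univ (M.ν θ) := by
    filter_upwards [M.μ.ae_pos] with x hx _ using hA θ x hx
  filter_upwards [ae_mem_of_law_eq hC hθ hD] with x hx using hx (mem_univ x)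

lemma measurable_log_ν (θ : Θ) : Measurable fun x => Real.log (M.ν θ x) :=
  Real.measurable_log.comp (M.ν θ).measurable

lemma integrable_log_ν [TopologicalSpace Θ] (hB : M.AssumptionB) (θ : Θ) :
    Integrable (fun x => Real.log (M.ν θ x)) M.μ.law := by
  obtain ⟨-, H, hH, hle⟩ := hB
  exact hH.mono' (M.measurable_log_ν θ).aestronglyMeasurable (ae_of_all _ fun x => hle θ x)

/-- Gibbs' inequality in the case of equality. Since every proposal is positive where `μ` is, the
zero-variance density of `C` can belong to the family only if `C` has full measure, so that it
is `μ` itself. -/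
lemma law_eq_of_mem_ceArgmax [TopologicalSpace Θ] (hA : M.AssumptionA) (hB : M.AssumptionB)
    {C : Set (Pt p)} (hC : MeasurableSet C) (h : ∃ θ, (M.ν θ).law = M.zeroVar C) {θ : Θ}
    (hθ : θ ∈ M.ceArgmax C) : (M.ν θ).law = M.zeroVar C := by
  have hfull := ae_mem_of_exists_law_eq hA hC h
  obtain ⟨θ₀, hθ₀⟩ := h
  have hpC : M.prob C = 1 := by
    have : M.μ.law C = M.μ.law univ :=
      measure_congr (by
        filter_upwards [hfull] with x hx using propext ⟨fun _ => trivial, fun _ => hx⟩)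
    simp [prob, measureReal_def, this]
  have hzv : M.zeroVar C = M.μ.law := by
    have h1 : M.μ.law C = 1 := by
      rw [← ENNReal.toReal_eq_one_iff]; exact hpC
    rw [zeroVar, ProbabilityTheory.cond, h1, Measure.restrict_eq_self_of_ae_mem hfull]
    simp
  have hν₀ : ∀ᵐ x ∂M.μ.law, M.ν θ₀ x = M.μ x := by
    filter_upwards [M.μ.law_absolutelyContinuous.ae_le (density_ae_eq_of_law_eq hC hθ₀), hfull]
      with x hx hxC
    rw [hx, hpC, indicator_of_mem hxC]; simp
  have hpop : ∀ θ', M.popCE C θ' = ∫ x, Real.log (M.ν θ' x) ∂M.μ.law := fun θ' => by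
    rw [popCE, Measure.restrict_eq_self_of_ae_mem hfull]
  have hle := hθ θ₀
  rw [hpop, hpop] at hle
  -- the likelihood ratio has mean at most one
  have hr : ∫⁻ x, ENNReal.ofReal (M.ν θ x / M.μ x) ∂M.μ.law ≤ 1 := by
    have hm : Measurable fun x => ENNReal.ofReal (M.ν θ x / M.μ x) :=
      ((M.ν θ).measurable.div M.μ.measurable).ennreal_ofReal
    rw [Density.law, lintegral_withDensity_eq_lintegral_mul _ M.μ.measurable_ofReal hm,
      ← (M.ν θ).mass]
    refine lintegral_mono fun x => ?_
    rw [Pi.mul_apply, ← ENNReal.ofReal_mul (M.μ.nonneg x)]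
    refine ENNReal.ofReal_le_ofReal ?_
    rcases (M.μ.nonneg x).eq_or_lt with h0 | h0
    · rw [← h0]; simpa using (M.ν θ).nonneg x
    · rw [mul_div_cancel₀ _ h0.ne']
  have hrm : AEStronglyMeasurable (fun x => M.ν θ x / M.μ x) M.μ.law :=
    ((M.ν θ).measurable.div M.μ.measurable).aestronglyMeasurable
  have hr0 : ∀ x, 0 ≤ M.ν θ x / M.μ x := fun x => div_nonneg ((M.ν θ).nonneg x) (M.μ.nonneg x)
  have hri : Integrable (fun x => M.ν θ x / M.μ x) M.μ.law :=
    (lintegral_ofReal_ne_top_iff_integrable hrm (ae_of_all _ hr0)).1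
      (hr.trans_lt ENNReal.one_lt_top).ne
  have hr1 : ∫ x, M.ν θ x / M.μ x ∂M.μ.law ≤ 1 := by
    rw [integral_eq_lintegral_of_nonneg_ae (ae_of_all _ hr0) hrm]
    exact ENNReal.toReal_le_of_le_ofReal zero_le_one (by simpa using hr)
  have hiθ := integrable_log_ν hB θ
  have hiθ₀ := integrable_log_ν hB θ₀
  set G : Pt p → ℝ := fun x =>
    M.ν θ x / M.μ x - 1 - (Real.log (M.ν θ x) - Real.log (M.ν θ₀ x)) with hG
  have hGi : Integrable G M.μ.law := (hri.sub (integrable_const 1)).sub (hiθ.sub hiθ₀)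
  have hlog : ∀ᵐ x ∂M.μ.law, 0 < M.ν θ x / M.μ x ∧
      Real.log (M.ν θ x) - Real.log (M.ν θ₀ x) = Real.log (M.ν θ x / M.μ x) := by
    filter_upwards [hν₀, M.μ.ae_pos] with x hx hμ
    have := hA θ x hμ
    exact ⟨by positivity, by rw [hx, Real.log_div this.ne' hμ.ne']⟩
  have hG0 : 0 ≤ᵐ[M.μ.law] G := by
    filter_upwards [hlog] with x hx
    simp only [hG, Pi.zero_apply, hx.2]
    linarith [Real.log_le_sub_one_of_pos hx.1]
  have hGint : ∫ x, G x ∂M.μ.law = 0 := by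
    refine le_antisymm ?_ (integral_nonneg_of_ae hG0)
    have : ∫ x, G x ∂M.μ.law = ∫ x, M.ν θ x / M.μ x ∂M.μ.law - 1 -
        (∫ x, Real.log (M.ν θ x) ∂M.μ.law - ∫ x, Real.log (M.ν θ₀ x) ∂M.μ.law) := by
      have h1 : Integrable (fun x => M.ν θ x / M.μ x - 1) M.μ.law := hri.sub (integrable_const 1)
      have h2 : Integrable (fun x => Real.log (M.ν θ x) - Real.log (M.ν θ₀ x)) M.μ.law :=
        hiθ.sub hiθ₀
      rw [hG, integral_sub h1 h2, integral_sub hri (integrable_const 1), integral_sub hiθ hiθ₀]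
      simp
    linarith
  have hGae := (integral_eq_zero_iff_of_nonneg_ae hG0 hGi).1 hGint
  have hνμ : ∀ᵐ x ∂M.μ.law, M.ν θ x = M.μ x := by
    filter_upwards [hGae, hlog, M.μ.ae_pos] with x hx hl hμ
    simp only [hG, Pi.zero_apply, hl.2] at hx
    by_contra hne
    have hne1 : M.ν θ x / M.μ x ≠ 1 := fun h => hne ((div_eq_one_iff_eq hμ.ne').1 h)
    linarith [Real.log_lt_sub_one_of_pos hl.1 hne1]
  have hae : (fun x => ENNReal.ofReal (M.μ x)) =ᵐ[volume] fun x => ENNReal.ofReal (M.ν θ x) := by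
    refine ae_eq_of_ae_le_of_lintegral_le ?_ (by rw [M.μ.mass]; simp)
      (M.ν θ).measurable_ofReal.aemeasurable (by rw [M.μ.mass, (M.ν θ).mass])
    filter_upwards [M.μ.ae_law_iff.1 hνμ] with x hx
    refine ENNReal.ofReal_le_ofReal ?_
    rcases (M.μ.nonneg x).eq_or_lt with h0 | h0
    · rw [← h0]; exact (M.ν θ).nonneg x
    · exact (hx h0).ge
  rw [hzv]
  exact (withDensity_congr_ae hae).symm

lemma scv_eq_zero_of_law_eq (hpA : 0 < M.prob M.A) {w : Density p} (hw : w.law = M.zeroVar M.A)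
    {N : ℕ} (hN : 1 ≤ N) : M.scv N w = 0 := by
  rw [M.scv_of_law_eq hpA M.measurableSet_A hw
    (dominates_of_law_eq M.measurableSet_A hw (ae_of_all _ fun _ h => h)) hN]
  simp

end Model

/-! ### Variance and minimality of the relaxed sets -/

namespace Stage

variable {p q K : ℕ} {Θ : Type*} {M : Model p q K Θ} {s : Stage p K}

lemma measurableSet_stdSet : MeasurableSet (s.stdSet M) :=
  measurableSet_le measurable_const (M.measurable_φ _)

lemma measurableSet_relSet : MeasurableSet (s.relSet M) :=
  measurableSet_le measurable_const (M.measurable_φ _)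

lemma A_subset_stdSet : M.A ⊆ s.stdSet M := fun x hx =>
  (min_le_right (s.γφ M) M.γstar).trans (show M.γstar ≤ M.score x from hx)

/-- Inclusion-exclusion for `A ⊆ Â` and an arbitrary set `R`. -/
lemma prob_excess (s : Stage p K) {R : Set (Pt p)} (hR : MeasurableSet R) :
    M.prob (s.stdSet M \ M.A) + M.prob (R \ s.stdSet M) - M.prob (s.stdSet M \ R)
      = M.prob R - M.prob M.A := by
  have h1 := measureReal_sdiff_add_inter (μ := M.μ.law) (s := R) (s.measurableSet_stdSet (M := M))
  have h2 := measureReal_sdiff_add_inter (μ := M.μ.law) (s := s.stdSet M) hR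
  have h3 := measureReal_sdiff_add_inter (μ := M.μ.law) (s := s.stdSet M) M.measurableSet_A
  rw [inter_eq_right.2 A_subset_stdSet] at h3
  rw [inter_comm] at h2
  unfold Model.prob
  linarith

lemma scvFormula [TopologicalSpace Θ] (hA : M.AssumptionA) (hB : M.AssumptionB)
    (hpA : 0 < M.prob M.A) : s.SCVFormula M := by
  constructor
  · intro h θ hθ N hN
    have hfull := Model.ae_mem_of_exists_law_eq hA measurableSet_relSet h
    have hlaw := Model.law_eq_of_mem_ceArgmax hA hB measurableSet_relSet h hθ
    have hD : M.Dominates M.A (M.ν θ) := by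
      filter_upwards [M.μ.ae_pos] with x hx _ using hA θ x hx
    have h0 : M.prob (s.stdSet M \ s.relSet M) = 0 := by
      have : M.μ.law (s.stdSet M \ s.relSet M) = 0 :=
        measure_mono_null (fun x hx => hx.2) hfull
      simp [Model.prob, measureReal_def, this]
    rw [M.scv_of_law_eq hpA measurableSet_relSet hlaw hD hN,
      ← s.prob_excess measurableSet_relSet, h0, sub_zero]
  · intro W hW hex w hw N hN
    rw [M.scv_of_law_eq hpA measurableSet_relSet (hw.law_eq hex) (hW w hw.1) hN,
      ← s.prob_excess measurableSet_relSet]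

lemma Admissible.feasible_relSet (hs : s.Admissible) (hns : ¬ s.Stopped M) :
    s.Feasible M (s.relSet M) := by
  refine ⟨measurableSet_relSet, fun ψ _ hψ x hx => ?_⟩
  have h1 : s.γk M ≤ quantile s.z s.m s.ρ ψ + s.α M :=
    quantile_le_add hs.1 hs.2 fun i _ => by linarith [(abs_le.1 (hψ (s.z i))).1]
  have h2 := (abs_le.1 (hψ x)).2
  have h3 : s.γk M < M.γstar + s.α M := not_le.1 hns
  change min (s.γk M - 2 * s.α M) (M.γstar + s.α M) ≤ M.φ s.k x
  refine (min_le_left _ _).trans ?_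
  have hx' : min (quantile s.z s.m s.ρ ψ) M.γstar ≤ ψ x := hx
  rcases min_le_iff.1 hx' with hx | hx <;> linarith

/-- The score that equals `φ^(k) - α` at the samples and `φ^(k) + α` elsewhere shows that a feasible
set contains the relaxed set, up to the samples. -/
lemma Admissible.relSet_ae_subset (hp : 0 < p) (hs : s.Admissible) (hns : ¬ s.Stopped M)
    {B : Set (Pt p)} (hB : s.Feasible M B) : ∀ᵐ x ∂M.μ.law, x ∈ s.relSet M → x ∈ B := by
  classical
  set S : Set (Pt p) := s.z '' {i | i < s.m} with hS
  have hSfin : S.Finite := (finite_lt_nat s.m).image _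
  have hα := s.α_nonneg M
  set ψ : Pt p → ℝ := fun x => if x ∈ S then M.φ s.k x - s.α M else M.φ s.k x + s.α M with hψ
  have hψm : Measurable ψ :=
    Measurable.ite hSfin.measurableSet ((M.measurable_φ _).sub_const _)
      ((M.measurable_φ _).add_const _)
  have hψd : ∀ x, |ψ x - M.φ s.k x| ≤ s.α M := fun x => by
    by_cases hx : x ∈ S <;> simp [hψ, hx, abs_of_nonneg hα]
  have hq : quantile s.z s.m s.ρ ψ ≤ s.γk M - s.α M := by
    refine quantile_le_add hs.1 hs.2 fun i hi => ?_
    have : s.z i ∈ S := ⟨i, hi, rfl⟩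
    simp only [hψ, this, if_true]; linarith
  have hn : M.μ.law S = 0 := by
    have : Nonempty (Fin p) := ⟨⟨0, hp⟩⟩
    exact M.μ.law_absolutelyContinuous (hSfin.measure_zero volume)
  have h3 : s.γk M < M.γstar + s.α M := not_le.1 hns
  filter_upwards [measure_eq_zero_iff_ae_notMem.1 hn] with x hx hxR
  refine hB.2 ψ hψm hψd ?_
  have hxR' : min (s.γk M - 2 * s.α M) (M.γstar + s.α M) ≤ M.φ s.k x := hxR
  rw [min_eq_left (by linarith)] at hxR'
  change min (quantile s.z s.m s.ρ ψ) M.γstar ≤ ψ x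
  refine (min_le_left _ _).trans (hq.trans ?_)
  simp only [hψ, hx, if_false]; linarith

lemma Admissible.scvMinimal (hp : 0 < p) (hpA : 0 < M.prob M.A) (hs : s.Admissible)
    (hns : ¬ s.Stopped M) : s.SCVMinimal M := by
  refine ⟨hs.feasible_relSet hns, fun B hB => ?_⟩
  have hsub := hs.relSet_ae_subset hp hns hB
  refine ⟨M.prob_mono_ae ?_, fun w w' hD hw hw' N hN => ?_⟩
  · filter_upwards [hsub] with x hx h using ⟨hx h.1, h.2⟩
  · have hD' : M.Dominates M.A w' := by
      refine Model.dominates_of_law_eq hB.1 hw' ?_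
      filter_upwards [hsub, Model.ae_mem_of_law_eq measurableSet_relSet hw hD] with x h1 h2 hx
        using h1 (h2 hx)
    rw [M.scv_of_law_eq hpA measurableSet_relSet hw hD hN, M.scv_of_law_eq hpA hB.1 hw' hD' hN]
    have := M.prob_mono_ae hsub
    gcongr

end Stage

/-! ### Finite bracketings of function classes -/

/-- The functions `F i`, `i ∈ s`, are covered by finitely many brackets. A bracket is a pair
`(b, r)` of a centre and a radius function, it covers the functions with `|f - b| ≤ r` on `G`, and
its radius has integral less than `η`. The set `G` has full measure in the applications and does not
depend on `i`. -/
def HasBrackets {X ι : Type*} [MeasurableSpace X] (P : Measure X) (G : Set X) (F : ι → X → ℝ)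
    (s : Set ι) (η : ℝ) : Prop :=
  ∃ B : Set ((X → ℝ) × (X → ℝ)), B.Finite ∧
    (∀ b ∈ B, (Measurable b.1 ∧ Integrable b.1 P) ∧ (Measurable b.2 ∧ Integrable b.2 P) ∧
      ∫ x, b.2 x ∂P < η) ∧
    ∀ i ∈ s, ∃ b ∈ B, ∀ x ∈ G, |F i x - b.1 x| ≤ b.2 x

section Brackets

variable {X : Type*} [MeasurableSpace X] {P : Measure X} {G : Set X}

lemma HasBrackets.of_local {ι : Type*} [TopologicalSpace ι] [CompactSpace ι] {F : ι → X → ℝ}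
    {η : ℝ} (h : ∀ i, ∃ V ∈ 𝓝 i, HasBrackets P G F V η) : HasBrackets P G F univ η := by
  refine isCompact_univ.induction_on (p := fun s => HasBrackets P G F s η) ?_ ?_ ?_ ?_
  · exact ⟨∅, finite_empty, by simp, by simp⟩
  · rintro s t hst ⟨B, h1, h2, h3⟩
    exact ⟨B, h1, h2, fun i hi => h3 i (hst hi)⟩
  · rintro s t ⟨B, h1, h2, h3⟩ ⟨B', h1', h2', h3'⟩
    refine ⟨B ∪ B', h1.union h1', ?_, ?_⟩
    · rintro b (hb | hb)
      · exact h2 b hb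
      · exact h2' b hb
    · rintro i (hi | hi)
      · obtain ⟨b, hb, h⟩ := h3 i hi; exact ⟨b, .inl hb, h⟩
      · obtain ⟨b, hb, h⟩ := h3' i hi; exact ⟨b, .inr hb, h⟩
  · intro i _
    obtain ⟨V, hV, h⟩ := h i
    exact ⟨V, mem_nhdsWithin_of_mem_nhds hV, h⟩

/-- A score takes values near `t₀`, but different from `t₀`, with small weighted probability. -/
lemma exists_nhds_integral_indicator_lt {T : Type*} [TopologicalSpace T] [T1Space T]
    [FirstCountableTopology T] [MeasurableSpace T] [BorelSpace T] {ψ : X → T} (hψ : Measurable ψ)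
    {H : X → ℝ} (hH : Integrable H P) (t₀ : T) {η : ℝ} (hη : 0 < η) :
    ∃ U ∈ 𝓝 t₀, MeasurableSet (ψ ⁻¹' (U \ {t₀})) ∧
      ∫ x, (ψ ⁻¹' (U \ {t₀})).indicator H x ∂P < η := by
  obtain ⟨U, hU, hbasis⟩ := (nhds_basis_opens t₀).exists_antitone_subbasis
  have hmeas : ∀ n, MeasurableSet (ψ ⁻¹' (U n \ {t₀})) := fun n =>
    hψ ((hU n).2.measurableSet.diff (measurableSet_singleton t₀))
  have hlim : Tendsto (fun n => ∫ x, (ψ ⁻¹' (U n \ {t₀})).indicator H x ∂P) atTop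
      (𝓝 (∫ _, 0 ∂P)) := by
    refine tendsto_integral_of_dominated_convergence (fun x => ‖H x‖)
      (fun n => hH.aestronglyMeasurable.indicator (hmeas n)) hH.norm
      (fun n => ae_of_all _ fun x => norm_indicator_le_norm_self _ _) (ae_of_all _ fun x => ?_)
    refine tendsto_const_nhds.congr' ?_
    by_cases hx : ψ x = t₀
    · exact Eventually.of_forall fun n => by simp [hx]
    · have : ({ψ x} : Set T)ᶜ ∈ 𝓝 t₀ := isOpen_compl_singleton.mem_nhds fun h => hx h.symm
      obtain ⟨n, hn⟩ := hbasis.mem_iff.1 this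
      filter_upwards [eventually_ge_atTop n] with k hk
      rw [indicator_of_notMem]
      exact fun h => hn (hbasis.antitone hk h.1) rfl
  rw [integral_zero] at hlim
  obtain ⟨n, hn⟩ := (hlim.eventually_lt_const hη).exists
  exact ⟨U n, (hU n).2.mem_nhds (hU n).1, hmeas n, hn⟩

/-- Functions that depend continuously on a parameter, with an integrable envelope, have a small
local modulus of continuity in the mean. The supremum in the modulus is taken over a countable dense
set of parameters, to be measurable. -/
lemma exists_nhds_modulus_lt {ι : Type*} [PseudoMetricSpace ι] [TopologicalSpace.SeparableSpace ι]
    {F : ι → X → ℝ} (hF : ∀ θ, Measurable (F θ)) (hG : ∀ᵐ x ∂P, x ∈ G)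
    (hFc : ∀ x ∈ G, Continuous fun θ => F θ x) {H : X → ℝ} (hH : Integrable H P)
    (hFH : ∀ x ∈ G, ∀ θ, |F θ x| ≤ H x) (θ₀ : ι) {η : ℝ} (hη : 0 < η) :
    ∃ U ∈ 𝓝 θ₀, ∃ r : X → ℝ, Measurable r ∧ Integrable r P ∧ ∫ x, r x ∂P < η ∧
      ∀ x ∈ G, ∀ θ ∈ U, |F θ x - F θ₀ x| ≤ r x := by
  classical
  have : Nonempty ι := ⟨θ₀⟩
  set D := TopologicalSpace.denseSeq ι
  set r : ℕ → X → ℝ := fun n x =>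
    ⨆ j, if dist (D j) θ₀ < 1 / ((n : ℝ) + 1) then |F (D j) x - F θ₀ x| else 0 with hr
  have hterm : ∀ x ∈ G, ∀ θ, |F θ x - F θ₀ x| ≤ 2 * H x := fun x hx θ => by
    have := abs_sub (F θ x) (F θ₀ x)
    linarith [hFH x hx θ, hFH x hx θ₀]
  have hite : ∀ n : ℕ, ∀ x ∈ G, ∀ j,
      (if dist (D j) θ₀ < 1 / ((n : ℝ) + 1) then |F (D j) x - F θ₀ x| else 0) ≤ 2 * H x := by
    intro n x hx j
    split_ifs
    · exact hterm x hx _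
    · exact (abs_nonneg _).trans (hterm x hx θ₀)
  have hr0 : ∀ n x, 0 ≤ r n x := fun n x => Real.iSup_nonneg fun j => by split_ifs <;> positivity
  have hr2 : ∀ n, ∀ x ∈ G, r n x ≤ 2 * H x := fun n x hx => ciSup_le (hite n x hx)
  have hrm : ∀ n, Measurable (r n) := fun n => Measurable.iSup fun j => by
    split_ifs
    · exact ((hF _).sub (hF _)).abs
    · exact measurable_const
  have hrb : ∀ n, ∀ᵐ x ∂P, ‖r n x‖ ≤ 2 * H x := fun n => by
    filter_upwards [hG] with x hx
    rw [Real.norm_of_nonneg (hr0 n x)]; exact hr2 n x hx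
  have hlim : Tendsto (fun n => ∫ x, r n x ∂P) atTop (𝓝 (∫ _, 0 ∂P)) := by
    refine tendsto_integral_of_dominated_convergence (fun x => 2 * H x)
      (fun n => (hrm n).aestronglyMeasurable) (hH.const_mul 2) hrb ?_
    filter_upwards [hG] with x hx
    rw [Metric.tendsto_atTop]
    intro e he
    obtain ⟨d, hd, hd'⟩ := Metric.continuous_iff.1 (hFc x hx) θ₀ (e / 2) (by positivity)
    obtain ⟨n, hn⟩ := exists_nat_one_div_lt hd
    refine ⟨n, fun k hk => ?_⟩
    have hle : r k x ≤ e / 2 := ciSup_le fun j => by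
      split_ifs with h
      · have h' : dist (D j) θ₀ < d :=
          h.trans (lt_of_le_of_lt (Nat.one_div_le_one_div hk) hn)
        exact (hd' _ h').le
      · positivity
    rw [Real.dist_eq, sub_zero, abs_of_nonneg (hr0 k x)]
    linarith
  rw [integral_zero] at hlim
  obtain ⟨n, hn⟩ := (hlim.eventually_lt_const hη).exists
  refine ⟨Metric.ball θ₀ (1 / ((n : ℝ) + 1)), Metric.ball_mem_nhds _ (by positivity), r n, hrm n,
    (hH.const_mul 2).mono' (hrm n).aestronglyMeasurable (hrb n), hn, fun x hx θ hθ => ?_⟩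
  by_contra hlt
  push Not at hlt
  have hopen : IsOpen (Metric.ball θ₀ (1 / ((n : ℝ) + 1)) ∩ {θ | r n x < |F θ x - F θ₀ x|}) :=
    Metric.isOpen_ball.inter
      (isOpen_lt continuous_const ((hFc x hx).sub continuous_const).abs)
  obtain ⟨j, hj⟩ := (TopologicalSpace.denseRange_denseSeq ι).exists_mem_open hopen ⟨θ, hθ, hlt⟩
  have h1 := le_ciSup (f := fun j => if dist (D j) θ₀ < 1 / ((n : ℝ) + 1) then
    |F (D j) x - F θ₀ x| else 0) ⟨2 * H x, by rintro _ ⟨j, rfl⟩; exact hite n x hx j⟩ j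
  rw [if_pos (show dist (D j) θ₀ < _ from hj.1)] at h1
  exact absurd hj.2 (not_lt.2 h1)

/-- The functions `1_{ψ ≥ t} F θ`, with `t` in a compact linear order and `θ` in a compact space,
have finite bracketings of every size: near `(t₀, θ₀)` the centres `1_{ψ ≥ t₀} F θ₀` (for `t ≤ t₀`)
and `1_{ψ > t₀} F θ₀` (for `t > t₀`) suffice. -/
lemma hasBrackets_indicator {T : Type*} [TopologicalSpace T] [LinearOrder T] [OrderTopology T]
    [CompactSpace T] [SecondCountableTopology T] [MeasurableSpace T] [BorelSpace T]
    {ι : Type*} [PseudoMetricSpace ι] [CompactSpace ι]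
    {F : ι → X → ℝ} (hF : ∀ θ, Measurable (F θ)) (hG : ∀ᵐ x ∂P, x ∈ G)
    (hFc : ∀ x ∈ G, Continuous fun θ => F θ x) {H : X → ℝ} (hHm : Measurable H)
    (hH : Integrable H P) (hFH : ∀ x ∈ G, ∀ θ, |F θ x| ≤ H x) {ψ : X → T} (hψ : Measurable ψ)
    {η : ℝ} (hη : 0 < η) :
    HasBrackets P G (fun i : T × ι => {x | i.1 ≤ ψ x}.indicator (F i.2)) univ η := by
  refine HasBrackets.of_local fun ⟨t₀, θ₀⟩ => ?_
  obtain ⟨U, hU, hUm, hUlt⟩ := exists_nhds_integral_indicator_lt hψ hH t₀ (half_pos hη)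
  obtain ⟨V, hV, r, hrm, hri, hrlt, hr⟩ :=
    exists_nhds_modulus_lt hF hG hFc hH hFH θ₀ (half_pos hη)
  set S := ψ ⁻¹' (U \ {t₀}) with hS
  set R : X → ℝ := fun x => S.indicator H x + r x with hR
  have hRm : Measurable R := (hHm.indicator hUm).add hrm
  have hRi : Integrable R P := (hH.indicator hUm).add hri
  have hRlt : ∫ x, R x ∂P < η := by
    rw [hR, integral_add (hH.indicator hUm) hri]; linarith
  have hFi : Integrable (F θ₀) P := hH.mono' (hF θ₀).aestronglyMeasurable (by
    filter_upwards [hG] with x hx using hFH x hx θ₀)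
  have hge : MeasurableSet {x | t₀ ≤ ψ x} := hψ measurableSet_Ici
  have hgt : MeasurableSet {x | t₀ < ψ x} := hψ measurableSet_Ioi
  have hH0 : ∀ x ∈ G, 0 ≤ H x := fun x hx => (abs_nonneg _).trans (hFH x hx θ₀)
  have hr0 : ∀ x ∈ G, 0 ≤ r x := fun x hx =>
    (abs_nonneg _).trans (hr x hx θ₀ (mem_of_mem_nhds hV))
  have hRr : ∀ x ∈ G, r x ≤ R x := fun x hx => by
    have : 0 ≤ S.indicator H x := indicator_apply_nonneg fun _ => hH0 x hx
    simp only [hR]; linarith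
  have hRH : ∀ x ∈ G, x ∈ S → H x ≤ R x := fun x hx hxS => by
    simp only [hR, indicator_of_mem hxS]; linarith [hr0 x hx]
  refine ⟨ordConnectedComponent U t₀ ×ˢ V,
    prod_mem_nhds (ordConnectedComponent_mem_nhds.2 hU) hV,
    {({x | t₀ ≤ ψ x}.indicator (F θ₀), R), ({x | t₀ < ψ x}.indicator (F θ₀), R)},
    toFinite _, ?_, ?_⟩
  · rintro b (rfl | rfl)
    · exact ⟨⟨(hF θ₀).indicator hge, hFi.indicator hge⟩, ⟨hRm, hRi⟩, hRlt⟩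
    · exact ⟨⟨(hF θ₀).indicator hgt, hFi.indicator hgt⟩, ⟨hRm, hRi⟩, hRlt⟩
  · rintro ⟨t, θ⟩ ⟨ht, hθ⟩
    have ht' : uIcc t₀ t ⊆ U := ht
    rcases le_or_gt t t₀ with htt | htt
    · refine ⟨_, .inl rfl, fun x hx => ?_⟩
      rw [uIcc_of_ge htt] at ht'
      by_cases h1 : t₀ ≤ ψ x
      · have h2 : t ≤ ψ x := htt.trans h1
        simpa [h1, h2] using (hr x hx θ hθ).trans (hRr x hx)
      · by_cases h2 : t ≤ ψ x
        · have hxS : x ∈ S := ⟨ht' ⟨h2, (not_le.1 h1).le⟩, (not_le.1 h1).ne⟩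
          simpa [h1, h2] using (hFH x hx θ).trans (hRH x hx hxS)
        · simpa [h1, h2] using (hr0 x hx).trans (hRr x hx)
    · refine ⟨_, .inr rfl, fun x hx => ?_⟩
      rw [uIcc_of_le htt.le] at ht'
      by_cases h1 : t ≤ ψ x
      · have h2 : t₀ < ψ x := htt.trans_le h1
        simpa [h1, h2] using (hr x hx θ hθ).trans (hRr x hx)
      · by_cases h2 : t₀ < ψ x
        · have hxS : x ∈ S := ⟨ht' ⟨h2.le, (not_le.1 h1).le⟩, h2.ne'⟩
          simpa [h1, h2] using (hFH x hx θ₀).trans (hRH x hx hxS)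
        · simpa [h1, h2] using (hr0 x hx).trans (hRr x hx)

end Brackets

/-! ### Uniform laws of large numbers with importance weights -/

section Stream

variable {p : ℕ} {g : Density p}

instance : IsProbabilityMeasure g.streamLaw := by
  unfold Density.streamLaw; infer_instance

lemma Density.ae_streamLaw_forall {Q : Pt p → Prop} (h : ∀ᵐ x ∂g.law, Q x) :
    ∀ᵐ z ∂g.streamLaw, ∀ i, Q (z i) :=
  ae_all_iff.2 fun i =>
    (measurePreserving_eval_infinitePi (fun _ : ℕ => g.law) i).quasiMeasurePreserving.ae h

/-- The average `(1/m) ∑ (μ(z_i)/g(z_i)) F(z_i)` over the first `m` samples. -/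
noncomputable def weightedMean (μ g : Density p) (z : ℕ → Pt p) (m : ℕ) (F : Pt p → ℝ) : ℝ :=
  (1 / (m : ℝ)) * ∑ i ∈ Finset.range m, μ (z i) / g (z i) * F (z i)

variable {μ : Density p}

lemma measurable_ofReal_div :
    Measurable fun x => ENNReal.ofReal (μ x / g x) :=
  (μ.measurable.div g.measurable).ennreal_ofReal

lemma law_eq_withDensity_div (hg : ∀ x, 0 < μ x → 0 < g x) :
    μ.law = g.law.withDensity fun x => ENNReal.ofReal (μ x / g x) := by
  rw [Density.law, Density.law, ← withDensity_mul _ g.measurable_ofReal measurable_ofReal_div]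
  congr 1
  ext x
  rw [Pi.mul_apply, ← ENNReal.ofReal_mul (g.nonneg x)]
  rcases (g.nonneg x).eq_or_lt with h0 | h0
  · have : μ x = 0 := le_antisymm (not_lt.1 fun h => (hg x h).ne h0) (μ.nonneg x)
    simp [this]
  · rw [mul_div_cancel₀ _ h0.ne']

lemma integrable_weighted (hg : ∀ x, 0 < μ x → 0 < g x) {F : Pt p → ℝ}
    (hF : Integrable F μ.law) : Integrable (fun x => μ x / g x * F x) g.law := by
  rw [law_eq_withDensity_div hg, integrable_withDensity_iff_integrable_smul'
    measurable_ofReal_div (by simp)] at hF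
  simpa [ENNReal.toReal_ofReal (div_nonneg (μ.nonneg _) (g.nonneg _))] using hF

lemma integral_weighted (hg : ∀ x, 0 < μ x → 0 < g x) (F : Pt p → ℝ) :
    ∫ x, μ x / g x * F x ∂g.law = ∫ x, F x ∂μ.law := by
  rw [law_eq_withDensity_div hg, integral_withDensity_eq_integral_toReal_smul
    measurable_ofReal_div (by simp)]
  simp [ENNReal.toReal_ofReal (div_nonneg (μ.nonneg _) (g.nonneg _))]

/-- The strong law of large numbers for importance weighted averages. -/
lemma ae_tendsto_weightedMean (hg : ∀ x, 0 < μ x → 0 < g x) {F : Pt p → ℝ} (hFm : Measurable F)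
    (hF : Integrable F μ.law) :
    ∀ᵐ z ∂g.streamLaw, Tendsto (fun m => weightedMean μ g z m F) atTop
      (𝓝 (∫ x, F x ∂μ.law)) := by
  set Y : Pt p → ℝ := fun x => μ x / g x * F x with hY
  have hYm : Measurable Y := (μ.measurable.div g.measurable).mul hFm
  have hmp : ∀ i, MeasurePreserving (fun z : ℕ → Pt p => z i) g.streamLaw g.law :=
    fun i => measurePreserving_eval_infinitePi (fun _ : ℕ => g.law) i
  have hint : Integrable (fun z : ℕ → Pt p => Y (z 0)) g.streamLaw :=
    (hmp 0).integrable_comp_of_integrable (integrable_weighted hg hF)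
  have hind : iIndepFun (fun i (z : ℕ → Pt p) => Y (z i)) g.streamLaw :=
    iIndepFun_infinitePi (X := fun _ => Y) fun _ => hYm
  have hid : ∀ i, IdentDistrib (fun z : ℕ → Pt p => Y (z i)) (fun z => Y (z 0))
      g.streamLaw g.streamLaw := fun i => by
    refine ⟨(hYm.comp (measurable_pi_apply i)).aemeasurable,
      (hYm.comp (measurable_pi_apply 0)).aemeasurable, ?_⟩
    change Measure.map (Y ∘ fun z : ℕ → Pt p => z i) _ = Measure.map (Y ∘ fun z : ℕ → Pt p => z 0) _
    rw [← Measure.map_map hYm (measurable_pi_apply i),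
      ← Measure.map_map hYm (measurable_pi_apply 0), (hmp i).map_eq, (hmp 0).map_eq]
  have hE : ∫ z : ℕ → Pt p, Y (z 0) ∂g.streamLaw = ∫ x, F x ∂μ.law := by
    have h1 := integral_map (μ := g.streamLaw) (φ := fun z : ℕ → Pt p => z 0) (f := Y)
      (measurable_pi_apply 0).aemeasurable hYm.aestronglyMeasurable
    rw [(hmp 0).map_eq] at h1
    rw [← h1, integral_weighted hg]
  have h := strong_law_ae (fun i (z : ℕ → Pt p) => Y (z i)) hint
    (fun i j hij => hind.indepFun hij) hid
  rw [hE] at h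
  filter_upwards [h] with z hz
  refine hz.congr fun m => ?_
  rw [weightedMean, one_div, smul_eq_mul]

lemma abs_weightedMean_sub_le {z : ℕ → Pt p} {G : Set (Pt p)} (hz : ∀ i, 0 < μ (z i) → z i ∈ G)
    {F b r : Pt p → ℝ} (h : ∀ x ∈ G, |F x - b x| ≤ r x) (m : ℕ) :
    |weightedMean μ g z m F - weightedMean μ g z m b| ≤ weightedMean μ g z m r := by
  unfold weightedMean
  rw [← mul_sub, ← Finset.sum_sub_distrib, abs_mul, abs_of_nonneg (by positivity)]
  gcongr
  refine (Finset.abs_sum_le_sum_abs _ _).trans (Finset.sum_le_sum fun i _ => ?_)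
  rw [← mul_sub, abs_mul, abs_of_nonneg (div_nonneg (μ.nonneg _) (g.nonneg _))]
  rcases (μ.nonneg (z i)).eq_or_lt with h0 | h0
  · simp [← h0]
  · exact mul_le_mul_of_nonneg_left (h _ (hz i h0)) (div_nonneg (μ.nonneg _) (g.nonneg _))

/-- A class with finite bracketings of every size obeys a uniform law of large numbers, since the
strong law holds almost surely for the countably many bracketing functions. -/
lemma ae_uniform_weightedMean (hg : ∀ x, 0 < μ x → 0 < g x) {ι : Type*} {F : ι → Pt p → ℝ}
    {G : Set (Pt p)} (hG : ∀ᵐ x ∂μ.law, x ∈ G) (hFm : ∀ i, Measurable (F i))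
    (hB : ∀ η > 0, HasBrackets μ.law G F univ η) :
    ∀ᵐ z ∂g.streamLaw, ∀ η > 0, ∃ m₀ : ℕ, ∀ m, m₀ ≤ m → ∀ i,
      |weightedMean μ g z m (F i) - ∫ x, F i x ∂μ.law| < η := by
  choose B hBfin hBint hBcov using fun n : ℕ => hB (1 / ((n : ℝ) + 1)) (by positivity)
  have hGs : ∀ᵐ z ∂g.streamLaw, ∀ i, 0 < μ (z i) → z i ∈ G := by
    refine g.ae_streamLaw_forall (Q := fun x => 0 < μ x → x ∈ G) ?_
    exact g.law_absolutelyContinuous.ae_le (μ.ae_law_iff.1 hG)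
  have hlim : ∀ᵐ z ∂g.streamLaw, ∀ n, ∀ b ∈ B n,
      Tendsto (fun m => weightedMean μ g z m b.1) atTop (𝓝 (∫ x, b.1 x ∂μ.law)) ∧
      Tendsto (fun m => weightedMean μ g z m b.2) atTop (𝓝 (∫ x, b.2 x ∂μ.law)) := by
    refine ae_all_iff.2 fun n => (ae_ball_iff (hBfin n).countable).2 fun b hb => ?_
    obtain ⟨⟨h1, h2⟩, ⟨h3, h4⟩, -⟩ := hBint n b hb
    exact (ae_tendsto_weightedMean hg h1 h2).and (ae_tendsto_weightedMean hg h3 h4)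
  filter_upwards [hGs, hlim] with z hzG hzlim η hη
  obtain ⟨n, hn⟩ := exists_nat_one_div_lt (show 0 < η / 4 by positivity)
  have hev : ∀ᶠ m in atTop, ∀ b ∈ B n,
      |weightedMean μ g z m b.1 - ∫ x, b.1 x ∂μ.law| < η / 4 ∧
      weightedMean μ g z m b.2 < ∫ x, b.2 x ∂μ.law + η / 4 := by
    refine (hBfin n).eventually_all.2 fun b hb => ?_
    have h1 := (hzlim n b hb).1.eventually (Metric.ball_mem_nhds _ (show 0 < η / 4 by positivity))
    have h2 := (hzlim n b hb).2.eventually_lt_const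
      (show ∫ x, b.2 x ∂μ.law < ∫ x, b.2 x ∂μ.law + η / 4 by linarith)
    filter_upwards [h1, h2] with m hm1 hm2 using ⟨hm1, hm2⟩
  obtain ⟨m₀, hm₀⟩ := eventually_atTop.1 hev
  refine ⟨m₀, fun m hm i => ?_⟩
  obtain ⟨b, hb, hcov⟩ := hBcov n i (mem_univ i)
  obtain ⟨⟨-, hb1⟩, ⟨-, hb2⟩, hblt⟩ := hBint n b hb
  obtain ⟨h1, h2⟩ := hm₀ m hm b hb
  have h3 := abs_weightedMean_sub_le (g := g) hzG hcov m
  have hcov' : ∀ᵐ x ∂μ.law, ‖F i x - b.1 x‖ ≤ b.2 x := by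
    filter_upwards [hG] with x hx using hcov x hx
  have hFb : Integrable (fun x => F i x - b.1 x) μ.law :=
    hb2.mono' ((hFm i).aestronglyMeasurable.sub hb1.aestronglyMeasurable) hcov'
  have hFi : Integrable (F i) μ.law := by
    have := hFb.add hb1
    refine this.congr (ae_of_all _ fun x => ?_)
    simp
  have h4 : |∫ x, F i x ∂μ.law - ∫ x, b.1 x ∂μ.law| ≤ ∫ x, b.2 x ∂μ.law := by
    rw [← integral_sub hFi hb1]
    exact norm_integral_le_of_norm_le hb2 hcov'
  rw [abs_lt] at h1 ⊢
  rw [abs_le] at h3 h4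
  constructor <;> linarith [h1.1, h1.2, h3.1, h3.2, h4.1, h4.2]

/-- The uniform law of large numbers over superlevel sets of a score and over a compact parameter
set. -/
lemma ae_uniform_weightedMean_superlevel (hg : ∀ x, 0 < μ x → 0 < g x) {ι : Type*}
    [PseudoMetricSpace ι] [CompactSpace ι] {F : ι → Pt p → ℝ} (hF : ∀ θ, Measurable (F θ))
    (hFc : ∀ᵐ x ∂μ.law, Continuous fun θ => F θ x) {H : Pt p → ℝ} (hH : Integrable H μ.law)
    (hFH : ∀ᵐ x ∂μ.law, ∀ θ, |F θ x| ≤ H x) {ψ : Pt p → ℝ} (hψ : Measurable ψ) :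
    ∀ᵐ z ∂g.streamLaw, ∀ η > 0, ∃ m₀ : ℕ, ∀ m, m₀ ≤ m → ∀ (t : ℝ) (θ : ι),
      |weightedMean μ g z m ({x | t ≤ ψ x}.indicator (F θ))
        - ∫ x in {x | t ≤ ψ x}, F θ x ∂μ.law| < η := by
  obtain ⟨H', hH'm, hHH'⟩ := hH.aestronglyMeasurable
  have hψ' : Measurable fun x => (ψ x : EReal) := hψ.coe_real_ereal
  set G : Set (Pt p) := {x | (Continuous fun θ => F θ x) ∧ ∀ θ, |F θ x| ≤ H' x} with hGdef
  have hG : ∀ᵐ x ∂μ.law, x ∈ G := by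
    filter_upwards [hFc, hFH, hHH'] with x h1 h2 h3
    exact ⟨h1, fun θ => h3 ▸ h2 θ⟩
  have h := ae_uniform_weightedMean hg (ι := EReal × ι) hG
    (fun i => (hF i.2).indicator (hψ' measurableSet_Ici))
    (fun η hη => hasBrackets_indicator hF hG (fun x hx => hx.1) hH'm.measurable
      (hH.congr hHH') (fun x hx => hx.2) hψ' hη)
  filter_upwards [h] with z hz η hη
  obtain ⟨m₀, hm₀⟩ := hz η hη
  refine ⟨m₀, fun m hm t θ => ?_⟩
  have h1 := hm₀ m hm (↑t, θ)
  have h2 : (fun x => (ψ x : EReal)) ⁻¹' Ici (t : EReal) = {x | t ≤ ψ x} := by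
    ext x; simp
  rw [h2] at h1
  rwa [integral_indicator (measurableSet_le measurable_const hψ)] at h1

end Stream

/-! ### Monte Carlo cross-entropy problems -/

namespace Model

variable {p q K : ℕ} {Θ : Type*} (M : Model p q K Θ)

lemma empCE_eq_weightedMean (g : Density p) (z : ℕ → Pt p) (m : ℕ) (C : Set (Pt p)) (θ : Θ) :
    M.empCE g z m C θ = weightedMean M.μ g z m (C.indicator fun x => Real.log (M.ν θ x)) := by
  unfold empCE weightedMean
  congr 1
  refine Finset.sum_congr rfl fun i _ => ?_
  by_cases h : z i ∈ C <;> simp [h]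

/-- The properties of a sample stream `z` of the proposal `g`, valid almost surely, on which the
algorithm relies. Continuity in the parameter is needed at the samples of positive weight only. The
uniform law of large numbers covers all superlevel sets of all score approximations, since the
relaxed sets depend on the samples. -/
structure GoodStream [TopologicalSpace Θ] (g : Density p) (z : ℕ → Pt p) : Prop where
  continuous : ∀ i, 0 < M.μ (z i) → Continuous fun θ => Real.log (M.ν θ (z i))
  hits : ∃ i, z i ∈ M.A
  uniform : ∀ η > 0, ∃ m₀ : ℕ, ∀ m, m₀ ≤ m → ∀ (k : Fin (K + 1)) (t : ℝ) (θ : Θ),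
    |M.empCE g z m {x | t ≤ M.φ k x} θ - M.popCE {x | t ≤ M.φ k x} θ| < η
  error : ∀ η > 0, ∃ m₀ : ℕ, ∀ m, m₀ ≤ m → ∀ k : Fin (K + 1),
    M.prob {x | ⨆ i : Fin m, M.ε k (z i) < M.ε k x} < η

lemma exists_uniform_index {ι : Type*} [Finite ι] {Q : ι → ℕ → Prop}
    (h : ∀ k, ∃ m₀ : ℕ, ∀ m, m₀ ≤ m → Q k m) : ∃ m₀ : ℕ, ∀ m, m₀ ≤ m → ∀ k, Q k m := by
  have : ∀ᶠ m in atTop, ∀ k, Q k m :=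
    eventually_all.2 fun k => eventually_atTop.2 (h k)
  exact eventually_atTop.1 this

variable {M}

/-- New points rarely exceed the largest sampled value of a statistic. All samples lie in the
complement of the corresponding superlevel sets, whose probability is therefore small by the
uniform law of large numbers. -/
lemma ae_prob_iSup_lt {g : Density p} (hg : ∀ x, 0 < M.μ x → 0 < g x) {ψ : Pt p → ℝ}
    (hψ : Measurable ψ) :
    ∀ᵐ z ∂g.streamLaw, ∀ η > 0, ∃ m₀ : ℕ, ∀ m, m₀ ≤ m →
      M.prob {x | ⨆ i : Fin m, ψ (z i) < ψ x} < η := by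
  filter_upwards [ae_uniform_weightedMean_superlevel (μ := M.μ) hg (ι := Unit)
    (F := fun _ _ => (1 : ℝ)) (fun _ => measurable_const)
    (ae_of_all _ fun _ => continuous_const) (H := fun _ => 1) (integrable_const _)
    (ae_of_all _ fun _ _ => by simp) hψ] with z hz η hη
  obtain ⟨m₀, hm₀⟩ := hz (η / 2) (half_pos hη)
  refine ⟨m₀, fun m hm => ?_⟩
  set b : ℝ := ⨆ i : Fin m, ψ (z i) with hb
  have hlt : ∀ t, b < t → M.μ.law {x | t ≤ ψ x} ≤ ENNReal.ofReal (η / 2) := by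
    intro t ht
    have h1 := hm₀ m hm t ()
    have h0 : weightedMean M.μ g z m ({x | t ≤ ψ x}.indicator fun _ => (1 : ℝ)) = 0 := by
      unfold weightedMean
      rw [Finset.sum_eq_zero, mul_zero]
      intro i hi
      have : ψ (z i) ≤ b :=
        le_ciSup (f := fun i : Fin m => ψ (z i)) (finite_range _).bddAbove
          ⟨i, Finset.mem_range.1 hi⟩
      rw [indicator_of_notMem, mul_zero]
      exact not_le.2 (this.trans_lt ht)
    rw [h0, setIntegral_const, smul_eq_mul, mul_one, zero_sub, abs_neg] at h1
    rw [← ofReal_measureReal]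
    exact ENNReal.ofReal_le_ofReal ((le_abs_self _).trans h1.le)
  have hU : {x | b < ψ x} = ⋃ n : ℕ, {x | b + 1 / ((n : ℝ) + 1) ≤ ψ x} := by
    ext x
    simp only [mem_iUnion, mem_ofPred_eq]
    constructor
    · intro h
      obtain ⟨n, hn⟩ := exists_nat_one_div_lt (sub_pos.2 h)
      exact ⟨n, by linarith⟩
    · rintro ⟨n, hn⟩
      have : (0 : ℝ) < 1 / ((n : ℝ) + 1) := by positivity
      linarith
  have hmono : Monotone fun n : ℕ => {x | b + 1 / ((n : ℝ) + 1) ≤ ψ x} := by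
    intro n n' hnn x hx
    have hx' : b + 1 / ((n : ℝ) + 1) ≤ ψ x := hx
    have := Nat.one_div_le_one_div (α := ℝ) hnn
    change b + 1 / ((n' : ℝ) + 1) ≤ ψ x
    linarith
  have hle : M.μ.law {x | b < ψ x} ≤ ENNReal.ofReal (η / 2) := by
    rw [hU, hmono.measure_iUnion]
    exact iSup_le fun n => hlt _ (lt_add_of_pos_right _ (by positivity))
  have := ENNReal.toReal_le_of_le_ofReal (half_pos hη).le hle
  exact lt_of_le_of_lt this (half_lt_self hη)

lemma ae_goodStream [PseudoMetricSpace Θ] [CompactSpace Θ] (hB : M.AssumptionB)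
    (hpA : 0 < M.prob M.A) {g : Density p} (hg : ∀ x, 0 < M.μ x → 0 < g x) :
    ∀ᵐ z ∂g.streamLaw, M.GoodStream g z := by
  obtain ⟨hcont, H, hH, hle⟩ := hB
  have h1 : ∀ᵐ z ∂g.streamLaw, ∀ i,
      0 < M.μ (z i) → Continuous fun θ => Real.log (M.ν θ (z i)) :=
    g.ae_streamLaw_forall (Q := fun x => 0 < M.μ x → Continuous fun θ => Real.log (M.ν θ x))
      (g.law_absolutelyContinuous.ae_le (M.μ.ae_law_iff.1 hcont))
  have h2 : ∀ᵐ z ∂g.streamLaw, ∃ i, z i ∈ M.A := by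
    have hi : Integrable (M.A.indicator fun _ => (1 : ℝ)) M.μ.law :=
      (integrable_const _).indicator M.measurableSet_A
    filter_upwards [ae_tendsto_weightedMean hg (measurable_const.indicator M.measurableSet_A) hi]
      with z hz
    by_contra hno
    push Not at hno
    have h0 : ∀ m, weightedMean M.μ g z m (M.A.indicator fun _ => (1 : ℝ)) = 0 := fun m => by
      simp [weightedMean, hno]
    simp only [h0] at hz
    rw [integral_indicator_const _ M.measurableSet_A, smul_eq_mul, mul_one] at hz
    exact hpA.ne (tendsto_nhds_unique tendsto_const_nhds hz)
  have h3 := ae_all_iff.2 fun k : Fin (K + 1) =>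
    ae_uniform_weightedMean_superlevel (μ := M.μ) hg
      (F := fun θ x => Real.log (M.ν θ x)) (fun θ => M.measurable_log_ν θ) hcont hH
      (ae_of_all _ fun x θ => hle θ x) (M.measurable_φ k)
  have h4 := ae_all_iff.2 fun k : Fin (K + 1) => ae_prob_iSup_lt hg (M.measurable_ε k)
  filter_upwards [h1, h2, h3, h4] with z hz1 hz2 hz3 hz4
  refine ⟨hz1, hz2, fun η hη => ?_, fun η hη => exists_uniform_index fun k => hz4 k η hη⟩
  refine exists_uniform_index
    (Q := fun k m => ∀ (t : ℝ) (θ : Θ), |M.empCE g z m {x | t ≤ M.φ k x} θ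
      - M.popCE {x | t ≤ M.φ k x} θ| < η) fun k => ?_
  obtain ⟨m₀, hm₀⟩ := hz3 k η hη
  refine ⟨m₀, fun m hm t θ => ?_⟩
  rw [empCE_eq_weightedMean]
  exact hm₀ m hm t θ

lemma GoodStream.exists_isEmpCE [TopologicalSpace Θ] [CompactSpace Θ] [Nonempty Θ]
    {g : Density p} {z : ℕ → Pt p} (h : M.GoodStream g z) (m : ℕ) (C : Set (Pt p)) :
    ∃ θ, M.IsEmpCE g z m C θ := by
  have hc : Continuous (M.empCE g z m C) := by
    unfold empCE
    refine continuous_const.mul (continuous_finsetSum _ fun i _ => ?_)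
    rcases (M.μ.nonneg (z i)).eq_or_lt with h0 | h0
    · simp only [← h0, zero_div, mul_zero, zero_mul]; exact continuous_const
    · exact continuous_const.mul (h.continuous i h0)
  obtain ⟨θ, -, hθ⟩ := isCompact_univ.exists_isMaxOn univ_nonempty hc.continuousOn
  exact ⟨θ, fun θ' => hθ (mem_univ θ')⟩

/-! ### Exact cross-entropy problems -/

lemma continuous_popCE [PseudoMetricSpace Θ] (hB : M.AssumptionB) (C : Set (Pt p)) :
    Continuous (M.popCE C) := by
  obtain ⟨hcont, H, hH, hle⟩ := hB
  exact continuous_of_dominated (fun θ => (M.measurable_log_ν θ).aestronglyMeasurable)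
    (fun θ => ae_of_all _ fun x => hle θ x) hH.restrict (ae_restrict_of_ae hcont)

lemma ceArgmax_nonempty [PseudoMetricSpace Θ] [CompactSpace Θ] [Nonempty Θ]
    (hB : M.AssumptionB) (C : Set (Pt p)) : (M.ceArgmax C).Nonempty := by
  obtain ⟨θ, -, hθ⟩ :=
    isCompact_univ.exists_isMaxOn univ_nonempty (continuous_popCE hB C).continuousOn
  exact ⟨θ, fun θ' => hθ (mem_univ θ')⟩

/-- Near-maximizers of a continuous function on a compact space are close to the maximizers. -/
lemma exists_gap {T : Type*} [PseudoMetricSpace T] [CompactSpace T] {f : T → ℝ}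
    (hf : Continuous f) {η : ℝ} (hη : 0 < η) :
    ∃ κ > 0, ∀ θ, (∀ θ', f θ' - f θ ≤ κ) →
      Metric.infDist θ {θ | ∀ θ', f θ' ≤ f θ} < η := by
  set E : Set T := {θ | ∀ θ', f θ' ≤ f θ}
  have hS : IsCompact {θ | η ≤ Metric.infDist θ E} :=
    (isClosed_le continuous_const (Metric.continuous_infDist_pt E)).isCompact
  rcases {θ | η ≤ Metric.infDist θ E}.eq_empty_or_nonempty with he | hne
  · refine ⟨1, one_pos, fun θ _ => ?_⟩
    by_contra h
    exact (he ▸ (show θ ∈ {θ | η ≤ Metric.infDist θ E} from not_lt.1 h) : θ ∈ (∅ : Set T))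
  · obtain ⟨θ₁, hθ₁, hmax⟩ := hS.exists_isMaxOn hne hf.continuousOn
    have hθ₁E : θ₁ ∉ E := fun h => by
      have h1 : η ≤ Metric.infDist θ₁ E := hθ₁
      rw [Metric.infDist_zero_of_mem h] at h1
      linarith
    obtain ⟨θ₂, hθ₂⟩ : ∃ θ₂, f θ₁ < f θ₂ := by
      by_contra h
      push Not at h
      exact hθ₁E h
    refine ⟨(f θ₂ - f θ₁) / 2, by linarith, fun θ hθ => ?_⟩
    by_contra h
    have h1 : f θ ≤ f θ₁ := hmax (not_lt.1 h)
    linarith [hθ θ₂]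

end Model

/-! ### Stages and runs -/

/-- A point of the standard set outside the relaxed set has an error bound beyond all the sampled
ones. -/
lemma Stage.Admissible.stdSet_diff_relSet_subset {p q K : ℕ} {Θ : Type*} {M : Model p q K Θ}
    {s : Stage p K} (hs : s.Admissible)
    (hns : ¬ s.Stopped M) :
    s.stdSet M \ s.relSet M ⊆ {x | ⨆ i : Fin s.m, M.ε s.k (s.z i) < M.ε s.k x} := by
  rintro x ⟨hx1, hx2⟩
  have h1 : min (s.γφ M) M.γstar ≤ M.score x := hx1
  have h2 : M.φ s.k x < min (s.γk M - 2 * s.α M) (M.γstar + s.α M) := not_le.1 hx2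
  have h3 : s.γk M < M.γstar + s.α M := not_le.1 hns
  have h4 := hs.γk_le M
  have h5 := h2.trans_le (min_le_left _ _)
  have h6 := (abs_le.1 (M.abs_score_sub_φ_le s.k x)).2
  have h7 : s.α M < M.c * M.ε s.k x := by
    rcases min_le_iff.1 h1 with h1 | h1 <;> linarith
  exact lt_of_mul_lt_mul_left h7 M.c.2

section Runs

variable {p q K : ℕ} {Θ : Type*} [PseudoMetricSpace Θ] {M : Model p q K Θ}

lemma sub_maximizer_lt {T : Type*} {e f : T → ℝ} {η : ℝ} (h : ∀ θ, |e θ - f θ| < η / 2)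
    {θ : T} (hθ : ∀ θ', e θ' ≤ e θ) (θ' : T) : f θ' - f θ < η := by
  have h1 := abs_lt.1 (h θ)
  have h2 := abs_lt.1 (h θ')
  linarith [hθ θ', h1.1, h1.2, h2.1, h2.2]

lemma Model.GoodStream.stageClaims [CompactSpace Θ] (hp : 0 < p) (hA : M.AssumptionA)
    (hB : M.AssumptionB) (hpA : 0 < M.prob M.A) {g : Density p} {z : ℕ → Pt p}
    (hz : M.GoodStream g z) {S : Set (Stage p K)}
    (hS : ∀ s ∈ S, s.Admissible ∧ s.g = g ∧ s.z = z) : StageClaims M S := by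
  refine ⟨fun s hs hns => ⟨Stage.scvFormula hA hB hpA, (hS s hs).1.scvMinimal hp hpA hns⟩,
    fun η hη => ?_⟩
  obtain ⟨κ, hκ, hgap⟩ := Model.exists_gap (Model.continuous_popCE hB M.A) hη
  obtain ⟨m₁, hm₁⟩ := hz.uniform (κ / 2) (half_pos hκ)
  obtain ⟨m₂, hm₂⟩ := hz.uniform (η / 2) (half_pos hη)
  obtain ⟨m₃, hm₃⟩ := hz.error η hη
  refine ⟨max m₁ (max m₂ m₃), fun s hs hm => ?_⟩
  obtain ⟨hadm, rfl, rfl⟩ := hS s hs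
  simp only [max_le_iff] at hm
  refine ⟨fun _ θ hθ => hgap θ fun θ' => ?_, fun hns => ⟨?_, fun θ hθ θ' => ?_⟩⟩
  · exact (sub_maximizer_lt
      (fun θ => hm₁ s.m hm.1 (Fin.last K) M.γstar θ) hθ θ').le
  · refine lt_of_le_of_lt ?_ (hm₃ s.m hm.2.2 s.k)
    exact M.prob_mono_ae (ae_of_all _ fun x hx => hadm.stdSet_diff_relSet_subset hns hx)
  · exact sub_maximizer_lt (fun θ => hm₂ s.m hm.2.1 s.k _ θ) hθ θ'

/-- One iteration of the main loop: it suffices to continue from the next stages reached with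
good sample streams. -/
lemma almostSureRun_succ [CompactSpace Θ] [Nonempty Θ] (hp : 0 < p) (hA : M.AssumptionA)
    (hB : M.AssumptionB) (hpA : 0 < M.prob M.A) {J : ℕ} {s : Stage p K} (hs : s.Admissible)
    (hz : M.GoodStream s.g s.z)
    (hnext : ∀ θ z n s', s.m ≤ n → s.Next M θ z n s' → M.GoodStream s'.g s'.z →
      AlmostSureRun M J s') : AlmostSureRun M (J + 1) s := by
  by_cases hst : s.Stopped M
  · exact .inl ⟨hst, hz.exists_isEmpCE _ _⟩
  refine .inr ⟨hst, hz.exists_isEmpCE _ _, fun θ _ => ?_⟩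
  filter_upwards [Model.ae_goodStream hB hpA (hA θ)] with z hz'
  refine ⟨fun n hn => Stage.exists_next hs θ hz'.hits hn, hz'.stageClaims hp hA hB hpA ?_,
    fun n hn s' hs' => ⟨hs'.quantileIncrease hs hn,
      hnext θ z n s' hn hs' (by rw [hs'.1, hs'.2.1]; exact hz')⟩⟩
  rintro s' ⟨n, hn, hs'⟩
  exact ⟨hs'.admissible hs hn, hs'.1, hs'.2.1⟩

/-- Each iteration raises the high-fidelity quantile by `δ` or up to `γ*`, and the loop is left one
test after the quantile has come within `δ` of `γ*`. -/
lemma almostSureRun [CompactSpace Θ] [Nonempty Θ] (hp : 0 < p) (hA : M.AssumptionA)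
    (hB : M.AssumptionB) (hpA : 0 < M.prob M.A) (J : ℕ) : ∀ s : Stage p K, s.Admissible →
      M.GoodStream s.g s.z → M.γstar ≤ s.γφ M + (J + 1) * M.δ → AlmostSureRun M (J + 2) s := by
  induction J with
  | zero =>
    intro s hs hz hγ
    refine almostSureRun_succ hp hA hB hpA hs hz fun θ z n s' hn hs' hz' => .inl ⟨?_, ?_⟩
    · exact hs'.stopped hs (by simpa using hγ)
    · exact hz'.exists_isEmpCE _ _
  | succ J ih =>
    intro s hs hz hγ
    refine almostSureRun_succ hp hA hB hpA hs hz fun θ z n s' hn hs' hz' =>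
      ih s' (hs'.admissible hs hn) hz' ?_
    have hinc : min M.γstar (s.γφ M + M.δ) ≤ s'.γφ M := hs'.quantileIncrease hs hn
    have hδ := M.δ_pos
    have hJ : (0 : ℝ) ≤ J * M.δ := by positivity
    push_cast at hγ
    rcases min_le_iff.1 hinc with h | h <;> linarith

end Runs

end CEMethod

theorem theorem2 {p q K : ℕ} (hp : 0 < p) {Θ : Type*} [MetricSpace Θ] [CompactSpace Θ]
    [Nonempty Θ] (M : CEMethod.Model p q K Θ) (hA : M.AssumptionA) (hB : M.AssumptionB)
    (hpA : 0 < M.prob M.A) :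
    (M.ceArgmax M.A).Nonempty ∧
    (∀ᵐ z ∂M.ν₀.streamLaw,
      CEMethod.StageClaims M {s | ∃ m, 1 ≤ m ∧ s = CEMethod.initStage M z m} ∧
      ∀ m, 1 ≤ m → CEMethod.AlmostSureRun M
        (max 2 (CEMethod.Jmax M (CEMethod.initStage M z m))).toNat
        (CEMethod.initStage M z m)) ∧
    ((∃ θ, (M.ν θ).law = M.zeroVar M.A) →
      ∀ θ ∈ M.ceArgmax M.A, ∀ N : ℕ, 1 ≤ N → M.scv N (M.ν θ) = 0) ∧
    (∀ W : Set (CEMethod.Density p), (∃ w ∈ W, w.law = M.zeroVar M.A) →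
      ∀ w, M.IsCEDensity W M.A w → ∀ N : ℕ, 1 ≤ N → M.scv N w = 0) := by
  refine ⟨CEMethod.Model.ceArgmax_nonempty hB _, ?_, fun h θ hθ N hN => ?_,
    fun W hW w hw N hN => ?_⟩
  · -- the `J` of `almostSureRun` is two less than the iteration bound of the statement
    filter_upwards [CEMethod.Model.ae_goodStream hB hpA M.ν₀_support] with z hz
    have hadm : ∀ m, 1 ≤ m → (CEMethod.initStage M z m).Admissible :=
      fun m hm => ⟨hm, M.ρ₀_pos, M.ρ₀_lt_one⟩
    refine ⟨hz.stageClaims hp hA hB hpA ?_, fun m hm => ?_⟩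
    · rintro s ⟨m, hm, rfl⟩
      exact ⟨hadm m hm, rfl, rfl⟩
    · set s := CEMethod.initStage M z m
      set J := (max 2 (CEMethod.Jmax M s)).toNat with hJ
      have hJcast : (J : ℤ) = max 2 (CEMethod.Jmax M s) :=
        Int.toNat_of_nonneg (le_trans (by norm_num) (le_max_left _ _))
      have hJ2 : 2 ≤ J := by
        have : (2 : ℤ) ≤ J := hJcast ▸ le_max_left _ _
        exact_mod_cast this
      obtain ⟨J', hJ'⟩ := Nat.exists_eq_add_of_le' hJ2
      rw [hJ']
      refine CEMethod.almostSureRun hp hA hB hpA J' s (hadm m hm) hz ?_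
      have h1 : ⌈(M.γstar - s.γφ M) / M.δ⌉ + 1 ≤ (J : ℤ) := hJcast ▸ le_max_right _ _
      have h2 : ⌈(M.γstar - s.γφ M) / M.δ⌉ ≤ (J' : ℤ) + 1 := by omega
      have h3 : (M.γstar - s.γφ M) / M.δ ≤ (J' : ℝ) + 1 := by
        refine (Int.le_ceil _).trans ?_
        exact_mod_cast h2
      rw [div_le_iff₀ M.δ_pos] at h3
      linarith
  · exact CEMethod.Model.scv_eq_zero_of_law_eq hpA
      (CEMethod.Model.law_eq_of_mem_ceArgmax hA hB M.measurableSet_A h hθ) hN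
  · exact CEMethod.Model.scv_eq_zero_of_law_eq hpA (hw.law_eq hW) hN
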